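/- Let $\mathbb K=\mathbb R$ or $\mathbb C$, let $M$ be a (finite-dimensional, Hausdorff) smooth manifold, and let $A$ and $B$ be (real, resp. complex) Lie algebroids over $M$, i.e. smooth $\mathbb K$-vector bundles of finite rank whose spaces of sections carry a $\mathbb K$-Lie bracket, with anchors $a:A\to TM\otimes\mathbb K$, $b:B\to TM\otimes\mathbb K$ that are bundle maps compatible with brackets, and with the Leibniz rule. Suppose $B$ is an $A$-module and $A$ is a $B$-module, i.e. we are given a flat $A$-connection on $B$ and a flat $B$-connection on $A$, both denoted $\nabla$. The pair $(A,B)$ is called a matched pair if for all $X,X_1,X_2\in\Gamma(A)$ and $Y,Y_1,Y_2\in\Gamma(B)$ $$[a(X),b(Y)]=-a(\nabla_YX)+b(\nabla_XY),$$ $$\nabla_X[Y_1,Y_2]=[\nabla_XY_1,Y_2]+[Y_1,\nabla_XY_2]+\nabla_{\nabla_{Y_2}X}Y_1-\nabla_{\nabla_{Y_1}X}Y_2,$$ $$\nabla_Y[X_1,X_2]=[\nabla_YX_1,X_2]+[X_1,\nabla_YX_2]+\nabla_{\nabla_{X_2}Y}X_1-\nabla_{\nabla_{X_1}Y}X_2.$$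 Let $\partial_A:\Gamma(\wedge^kA^*\otimes\wedge^lB^*)\to\Gamma(\wedge^{k+1}A^*\otimes\wedge^lB^*)$ and $\partial_B:\Gamma(\wedge^kA^*\otimes\wedge^lB^*)\to\Gamma(\wedge^kA^*\otimes\wedge^{l+1}B^*)$ be the Lie algebroid differentials of $A$ with values in the module $\wedge^lB^*$ and of $B$ with values in the module $\wedge^kA^*$, that is, $$(\partial_A\alpha)(A_0,\dots,A_k,B_1,\dots,B_l)=\sum_{i=0}^k(-1)^i\Big(a(A_i)\,\alpha(A_0,\dots,\widehat{A_i},\dots,A_k,B_1,\dots,B_l)-\sum_{j=1}^l\alpha(A_0,\dots,\widehat{A_i},\dots,A_k,B_1,\dots,\nabla_{A_i}B_j,\dots,B_l)\Big)$$ $$\qquad+\sum_{i<j}(-1)^{i+j}\alpha([A_i,A_j],A_0,\dots,\widehat{A_i},\dots,\widehat{A_j},\dots,A_k,B_1,\dots,B_l)$$ and $$(\partial_B\alpha)(A_1,\dots,A_k,B_0,\dots,B_l)=\sum_{i=0}^l(-1)^i\Big(b(B_i)\,\alpha(A_1,\dots,A_k,B_0,\dots,\widehat{B_i},\dots,B_l)-\sum_{j=1}^k\alpha(A_1,\dots,\nabla_{B_i}A_j,\dots,A_k,B_0,\dots,\widehat{B_i},\dots,B_l)\Big)$$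 $$\qquad+\sum_{i<j}(-1)^{i+j}\alpha(A_1,\dots,A_k,[B_i,B_j],B_0,\dots,\widehat{B_i},\dots,\widehat{B_j},\dots,B_l).$$ Then: 1. $\partial_A^2=0$ and $\partial_B^2=0$. 2. $(A,B)$ is a matched pair if and only if $\partial_B\partial_A=\partial_A\partial_B$ on $\Gamma(\wedge^kA^*\otimes\wedge^lB^*)$ for all $k,l\ge 0$, i.e. if and only if these spaces and operators form a (commuting) double complex. 3. If $(A,B)$ is a matched pair, then the direct sum bundle $A\oplus B$ has a Lie algebroid structure $A\bowtie B$ with anchor $X\oplus Y\mapsto a(X)+b(Y)$ and bracket $$[X_1\oplus Y_1,X_2\oplus Y_2]=\big([X_1,X_2]+\nabla_{Y_1}X_2-\nabla_{Y_2}X_1\big)\oplus\big([Y_1,Y_2]+\nabla_{X_1}Y_2-\nabla_{X_2}Y_1\big),$$ and its Lie algebroid cohomology with trivial coefficients is isomorphic to the total cohomology of the double complex, i.e. to the cohomology of $\bigoplus_{k+l=n}\Gamma(\wedge^kA^*\otimes\wedge^lB^*)$ with the differential $\partial_A+(-1)^k\partial_B$ (which squares to zero). The isomorphism is induced by the restriction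 of forms on $A\oplus B$ to $k$ arguments in $A$ and $l$ arguments in $B$, which is a morphism of complexes. -/

import Mathlib

set_option linter.unusedSectionVars false

/-! ## Lie–Rinehart algebra of a Lie algebroid, connections, and cochain complexes -/

/-- The algebraic structure carried by the sections of a Lie algebroid: a `𝕂`-Lie algebra `L` which
is a module over the commutative `𝕂`-algebra `R`, with an `R`-linear anchor into the derivations
of `R` that is a morphism of Lie algebras and for which the bracket satisfies the Leibniz rule. -/
structure LieRinehartStr (𝕂 R L : Type*) [Field 𝕂] [CommRing R] [Algebra 𝕂 R]
    [AddCommGroup L] [Module R L] [Module 𝕂 L] where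
  bracket : L →ₗ[𝕂] L →ₗ[𝕂] L
  anchor : L →ₗ[R] Derivation 𝕂 R R
  bracket_self : ∀ X, bracket X X = 0
  jacobi : ∀ X Y Z, bracket X (bracket Y Z) = bracket (bracket X Y) Z + bracket Y (bracket X Z)
  anchor_bracket : ∀ X Y, anchor (bracket X Y) = ⁅anchor X, anchor Y⁆
  leibniz : ∀ X (f : R) Y, bracket X (f • Y) = f • bracket X Y + anchor X f • Y

/-- A connection of `A` on the `R`-module `N`. -/
structure LieRinehartStr.Connection {𝕂 R L : Type*} [Field 𝕂] [CommRing R] [Algebra 𝕂 R]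
    [AddCommGroup L] [Module R L] [Module 𝕂 L] (A : LieRinehartStr 𝕂 R L)
    (N : Type*) [AddCommGroup N] [Module R N] [Module 𝕂 N] where
  nabla : L →ₗ[𝕂] N →ₗ[𝕂] N
  nabla_smul_left : ∀ (f : R) X n, nabla (f • X) n = f • nabla X n
  nabla_smul_right : ∀ (f : R) X n, nabla X (f • n) = f • nabla X n + A.anchor X f • n

/-- A representation of `A` on `N` (an `A`-module structure): a flat connection. -/
structure LieRinehartStr.Representation {𝕂 R L : Type*} [Field 𝕂] [CommRing R] [Algebra 𝕂 R]
    [AddCommGroup L] [Module R L] [Module 𝕂 L] (A : LieRinehartStr 𝕂 R L)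
    (N : Type*) [AddCommGroup N] [Module R N] [Module 𝕂 N] extends A.Connection N where
  flat : ∀ X Y n, nabla (A.bracket X Y) n = nabla X (nabla Y n) - nabla Y (nabla X n)

namespace LieRinehartStr

variable {𝕂 R L N P : Type*} [Field 𝕂] [CommRing R] [Algebra 𝕂 R]
  [AddCommGroup L] [Module R L] [Module 𝕂 L] [IsScalarTower 𝕂 R L]
  [AddCommGroup N] [Module R N] [Module 𝕂 N] [IsScalarTower 𝕂 R N]
  [AddCommGroup P] [Module R P] [Module 𝕂 P] [IsScalarTower 𝕂 R P]

instance (n : ℕ) : IsScalarTower 𝕂 R (L [⋀^Fin n]→ₗ[R] N) :=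
  ⟨fun c f ω => by ext v; exact smul_assoc c f (ω v)⟩

/-- The trivial representation of `A` on `R`, through the anchor. -/
def trivialRep (A : LieRinehartStr 𝕂 R L) : A.Representation R where
  nabla :=
    { toFun := fun X => (A.anchor X : R →ₗ[𝕂] R)
      map_add' := fun X Y => by ext f; simp
      map_smul' := fun c X => by
        ext f
        rw [← algebraMap_smul R c X, map_smul]
        simp [Algebra.smul_def] }
  nabla_smul_left := fun f X n => by simp
  nabla_smul_right := fun f X n => by
    simp [mul_comm]
  flat := fun X Y n => by
    change A.anchor (A.bracket X Y) n = _
    rw [A.anchor_bracket, Derivation.commutator_apply]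
    rfl

theorem Connection.update_ne {A : LieRinehartStr 𝕂 R L} (D : A.Connection P) {l : ℕ}
    (X : L) (Y : Fin l → P) {i j : Fin l} (h : j ≠ i) (x : P) :
    Function.update (Function.update Y i x) j (D.nabla X (Function.update Y i x j)) =
      Function.update (Function.update Y j (D.nabla X (Y j))) i x := by
  rw [Function.update_of_ne h, Function.update_comm h]

/-- The connection induced by a connection `D` on `P` on the module `∧ˡ P*` of alternating
`l`-forms on `P`: `(∇_X β)(Y₁,…,Yₗ) = X(β(Y₁,…,Yₗ)) - ∑ⱼ β(Y₁,…,∇_X Yⱼ,…,Yₗ)`. -/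
def Connection.exteriorDual {A : LieRinehartStr 𝕂 R L} (D : A.Connection P) (l : ℕ) :
    A.Connection (P [⋀^Fin l]→ₗ[R] R) where
  nabla := LinearMap.mk₂ 𝕂
    (fun X β =>
      { toFun := fun Y => A.anchor X (β Y) -
          ∑ j, β (Function.update Y j (D.nabla X (Y j)))
        map_update_add' := by
          intro inst Y i x y
          obtain rfl : inst = instDecidableEqFin l := Subsingleton.elim _ _
          have key : ∀ j, β (Function.update (Function.update Y i (x + y)) j
                (D.nabla X (Function.update Y i (x + y) j))) =
              β (Function.update (Function.update Y i x) j
                (D.nabla X (Function.update Y i x j))) +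
              β (Function.update (Function.update Y i y) j
                (D.nabla X (Function.update Y i y j))) := by
            intro j
            by_cases h : j = i
            · subst h
              simp
            · simp only [D.update_ne X Y h, AlternatingMap.map_update_add]
          simp only [key, AlternatingMap.map_update_add, map_add, Finset.sum_add_distrib]
          abel
        map_update_smul' := by
          intro inst Y i c x
          obtain rfl : inst = instDecidableEqFin l := Subsingleton.elim _ _
          have key : ∀ j, β (Function.update (Function.update Y i (c • x)) j
                (D.nabla X (Function.update Y i (c • x) j))) =
              c • β (Function.update (Function.update Y i x) j
                (D.nabla X (Function.update Y i x j))) +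
              if j = i then A.anchor X c • β (Function.update Y i x) else 0 := by
            intro j
            by_cases h : j = i
            · subst h
              simp [D.nabla_smul_right]
            · simp only [D.update_ne X Y h, AlternatingMap.map_update_smul, if_neg h, add_zero]
          simp only [key, AlternatingMap.map_update_smul, Finset.sum_add_distrib,
            Finset.sum_ite_eq', Finset.mem_univ, if_true, ← Finset.mul_sum, smul_eq_mul,
            Derivation.leibniz]
          ring
        map_eq_zero_of_eq' := by
          intro Y p q h hpq
          rw [β.map_eq_zero_of_eq Y h hpq, map_zero, zero_sub, neg_eq_zero,
            Fintype.sum_eq_add p q hpq]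
          · have hs : Function.update Y q (D.nabla X (Y q)) =
                Function.update Y p (D.nabla X (Y p)) ∘ Equiv.swap p q := by
              funext r
              rcases eq_or_ne r p with rfl | hrp
              · simp [Function.update_of_ne hpq, Function.update_of_ne hpq.symm, h]
              rcases eq_or_ne r q with rfl | hrq
              · simp [h]
              · simp [Equiv.swap_apply_of_ne_of_ne hrp hrq, hrp, hrq]
            rw [hs, β.map_swap _ hpq, add_neg_cancel]
          · rintro j ⟨hjp, hjq⟩
            refine β.map_eq_zero_of_eq _ ?_ hpq
            rw [Function.update_of_ne hjp.symm, Function.update_of_ne hjq.symm, h] })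
    (by
      intro X X' β; ext Y
      simp [Finset.sum_add_distrib]
      abel)
    (by
      intro c X β; ext Y
      have h : ∀ j y, β (Function.update Y j (c • y)) = c • β (Function.update Y j y) := by
        intro j y
        rw [← algebraMap_smul R c y, AlternatingMap.map_update_smul, algebraMap_smul]
      simp [h, Finset.smul_sum, smul_sub])
    (by
      intro X β β'; ext Y
      simp [Finset.sum_add_distrib]
      abel)
    (by
      intro c X β; ext Y
      simp [Finset.smul_sum, smul_sub])
  nabla_smul_left := by
    intro f X β; ext Y
    simp [D.nabla_smul_left, Finset.mul_sum, mul_sub]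
  nabla_smul_right := by
    intro f X β; ext Y
    simp [← Finset.mul_sum]
    ring

/-- The terms `∑_{i<j} (-1)^{i+j} ω([X_i,X_j],X_0,…,X̂_i,…,X̂_j,…,X_n)`. The index pair `i ≤ j`
below stands for the pair `i < j + 1`, which accounts for the sign. -/
def bracketTerm (A : LieRinehartStr 𝕂 R L) :
    ∀ {n : ℕ}, (L [⋀^Fin n]→ₗ[R] N) → (Fin (n + 1) → L) → N
  | 0, _, _ => 0
  | m + 1, ω, v => - ∑ i : Fin (m + 1), ∑ j ∈ Finset.Ici i, (-1 : ℤ) ^ (i + j : ℕ) •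
      ω (Matrix.vecCons (A.bracket (v i.castSucc) (v j.succ))
        (j.removeNth (i.castSucc.removeNth v)))

/-- The Lie algebroid differential with values in `N`, evaluated on `X_0,…,X_n`:
`∑_i (-1)^i ∇_{X_i} (ω(X_0,…,X̂_i,…,X_n)) + ∑_{i<j} (-1)^{i+j} ω([X_i,X_j],…,X̂_i,…,X̂_j,…)`. -/
def differentialFun {A : LieRinehartStr 𝕂 R L} (D : A.Connection N) {n : ℕ}
    (ω : L [⋀^Fin n]→ₗ[R] N) (v : Fin (n + 1) → L) : N :=
  ∑ i : Fin (n + 1), (-1 : ℤ) ^ (i : ℕ) • D.nabla (v i) (ω (i.removeNth v)) + A.bracketTerm ω v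

/-- Forgetting `R`-linearity of an alternating map. -/
def restrictForm {n : ℕ} (ω : L [⋀^Fin n]→ₗ[R] N) : L [⋀^Fin n]→ₗ[𝕂] N :=
  { ω.toMultilinearMap.restrictScalars 𝕂 with map_eq_zero_of_eq' := ω.map_eq_zero_of_eq' }

/-- The differential as a `𝕂`-multilinear alternating map. -/
def differentialAux [CharZero 𝕂] {A : LieRinehartStr 𝕂 R L} (D : A.Connection N) :
    ∀ {n : ℕ}, (L [⋀^Fin n]→ₗ[R] N) → L [⋀^Fin (n + 1)]→ₗ[𝕂] N
  | 0, ω => AlternatingMap.alternatizeUncurryFin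
      { toFun := fun X => (D.nabla X).compAlternatingMap (restrictForm (𝕂 := 𝕂) ω)
        map_add' := fun X Y => by ext v; simp
        map_smul' := fun c X => by ext v; simp }
  | m + 1, ω => AlternatingMap.alternatizeUncurryFin
      { toFun := fun X => (D.nabla X).compAlternatingMap (restrictForm (𝕂 := 𝕂) ω)
        map_add' := fun X Y => by ext v; simp
        map_smul' := fun c X => by ext v; simp } -
      (2⁻¹ : 𝕂) • AlternatingMap.alternatizeUncurryFin (AlternatingMap.alternatizeUncurryFinLM ∘ₗ
        A.bracket.compr₂ (restrictForm (𝕂 := 𝕂) ω).curryLeft)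

theorem differentialAux_apply [CharZero 𝕂] {A : LieRinehartStr 𝕂 R L} (D : A.Connection N) {n : ℕ}
    (ω : L [⋀^Fin n]→ₗ[R] N) (v : Fin (n + 1) → L) :
    differentialAux D ω v = differentialFun D ω v := by
  have anti : ∀ X Y, A.bracket Y X = - A.bracket X Y := by
    intro X Y
    have := A.bracket_self (X + Y)
    simp only [map_add, LinearMap.add_apply, A.bracket_self] at this
    rw [zero_add, add_zero] at this
    exact eq_neg_of_add_eq_zero_left this
  cases n with
  | zero =>
    simp [differentialAux, differentialFun, bracketTerm, restrictForm,
      AlternatingMap.alternatizeUncurryFin_apply]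
    rfl
  | succ m =>
    rw [differentialAux, AlternatingMap.sub_apply, AlternatingMap.smul_apply,
      AlternatingMap.alternatizeUncurryFin_alternatizeUncurryFinLM_comp_apply, differentialFun,
      bracketTerm, sub_eq_add_neg, AlternatingMap.alternatizeUncurryFin_apply]
    congr 2
    simp only [LinearMap.compr₂_apply, Finset.smul_sum]
    refine Finset.sum_congr rfl fun i _ => Finset.sum_congr rfl fun j _ => ?_
    rw [anti (v i.castSucc), map_neg, AlternatingMap.neg_apply, sub_neg_eq_add, ← two_smul 𝕂,
      smul_comm _ ((-1 : ℤ) ^ (i + j : ℕ)), smul_smul, inv_mul_cancel₀ two_ne_zero, one_smul]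
    rfl

theorem differentialFun_cons_smul {A : LieRinehartStr 𝕂 R L} (D : A.Connection N) {n : ℕ}
    (ω : L [⋀^Fin n]→ₗ[R] N) (f : R) (x : L) (w : Fin n → L) :
    differentialFun D ω (Matrix.vecCons (f • x) w) =
      f • differentialFun D ω (Matrix.vecCons x w) := by
  have anti : ∀ X Y, A.bracket Y X = - A.bracket X Y := by
    intro X Y
    have := A.bracket_self (X + Y)
    simp only [map_add, LinearMap.add_apply, A.bracket_self] at this
    rw [zero_add, add_zero] at this
    exact eq_neg_of_add_eq_zero_left this
  have leib : ∀ Z, A.bracket (f • x) Z = f • A.bracket x Z - A.anchor Z f • x := by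
    intro Z
    rw [anti Z (f • x), A.leibniz, anti x Z]
    rw [neg_add, smul_neg, neg_neg, sub_eq_add_neg]
  have rem : ∀ {m : ℕ} (y : L) (u : Fin (m + 1) → L) (i : Fin (m + 1)),
      i.succ.removeNth (Matrix.vecCons y u : Fin (m + 2) → L) =
        (Matrix.vecCons y (i.removeNth u) : Fin (m + 1) → L) := by
    intro m y u i
    funext j
    refine Fin.cases ?_ (fun j => ?_) j
    · simp [Fin.removeNth_apply]
    · simp [Fin.removeNth_apply]
  have consz : ∀ {m : ℕ} (y : L) (u : Fin m → L),
      (0 : Fin (m + 1)).removeNth (Matrix.vecCons y u : Fin (m + 1) → L) = u := by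
    intro m y u
    funext j
    simp [Fin.removeNth_apply]
  have cs : ∀ {m : ℕ} (α : L [⋀^Fin (m + 1)]→ₗ[R] N) (c : R) (y : L) (u : Fin m → L),
      α (Matrix.vecCons (c • y) u) = c • α (Matrix.vecCons y u) := fun α c y u =>
    α.map_vecCons_smul u c y
  have cs' : ∀ {m : ℕ} (α : L [⋀^Fin (m + 2)]→ₗ[R] N) (c : R) (z y : L) (u : Fin m → L),
      α (Matrix.vecCons z (Matrix.vecCons (c • y) u)) =
        c • α (Matrix.vecCons z (Matrix.vecCons y u)) := fun α c z y u =>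
    (α.curryLeft z).map_vecCons_smul u c y
  have sub1 : ∀ {m : ℕ} (α : L [⋀^Fin (m + 1)]→ₗ[R] N) (y z : L) (u : Fin m → L),
      α (Matrix.vecCons (y - z) u) = α (Matrix.vecCons y u) - α (Matrix.vecCons z u) := by
    intro m α y z u
    exact congrArg (fun a => a u) (α.curryLeft.map_sub y z)
  cases n with
  | zero =>
    simp [differentialFun, bracketTerm, D.nabla_smul_left, consz]
  | succ m =>
    have h1 : ∀ y, bracketTerm A ω (Matrix.vecCons y w) =
        - (∑ j : Fin (m + 1), (-1 : ℤ) ^ (j : ℕ) •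
            ω (Matrix.vecCons (A.bracket y (w j)) (j.removeNth w))) -
        ∑ i : Fin m, ∑ j ∈ Finset.Ici i.succ, (-1 : ℤ) ^ ((i : ℕ) + 1 + j : ℕ) •
          ω (Matrix.vecCons (A.bracket (w i.castSucc) (w j))
            (j.removeNth (i.succ.castSucc.removeNth (Matrix.vecCons y w : Fin (m + 2) → L)))) := by
      intro y
      rw [bracketTerm, Fin.sum_univ_succ, neg_add, ← sub_eq_add_neg]
      congr 2
      have : Finset.Ici (0 : Fin (m + 1)) = Finset.univ := by ext; simp
      rw [this]
      refine Finset.sum_congr rfl fun j _ => ?_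
      simp [consz]
    have h2 : ∀ i : Fin m, ∀ j ∈ Finset.Ici i.succ,
        ω (Matrix.vecCons (A.bracket (w i.castSucc) (w j))
          (j.removeNth (i.succ.castSucc.removeNth (Matrix.vecCons (f • x) w : Fin (m + 2) → L)))) =
        f • ω (Matrix.vecCons (A.bracket (w i.castSucc) (w j))
          (j.removeNth (i.succ.castSucc.removeNth (Matrix.vecCons x w : Fin (m + 2) → L)))) := by
      intro i j hj
      rw [Finset.mem_Ici] at hj
      obtain ⟨j, rfl⟩ : ∃ j', j = Fin.succ j' :=
        ⟨j.pred (fun h => by simp [h] at hj), by simp⟩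
      obtain _ | m := m
      · exact i.elim0
      rw [← Fin.succ_castSucc, rem, rem, rem, rem, cs']
    have h3 : bracketTerm A ω (Matrix.vecCons (f • x) w) =
        f • bracketTerm A ω (Matrix.vecCons x w) +
          ∑ j : Fin (m + 1), (-1 : ℤ) ^ (j : ℕ) •
            (A.anchor (w j) f • ω (Matrix.vecCons x (j.removeNth w))) := by
      rw [h1, h1, smul_sub, smul_neg, Finset.smul_sum, Finset.smul_sum]
      have e1 : ∀ i : Fin m, ∑ j ∈ Finset.Ici i.succ, (-1 : ℤ) ^ ((i : ℕ) + 1 + j : ℕ) •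
          ω (Matrix.vecCons (A.bracket (w i.castSucc) (w j))
            (j.removeNth (i.succ.castSucc.removeNth
              (Matrix.vecCons (f • x) w : Fin (m + 2) → L)))) =
          f • ∑ j ∈ Finset.Ici i.succ, (-1 : ℤ) ^ ((i : ℕ) + 1 + j : ℕ) •
          ω (Matrix.vecCons (A.bracket (w i.castSucc) (w j))
            (j.removeNth (i.succ.castSucc.removeNth
              (Matrix.vecCons x w : Fin (m + 2) → L)))) := by
        intro i
        rw [Finset.smul_sum]
        refine Finset.sum_congr rfl fun j hj => ?_
        rw [h2 i j hj, smul_comm]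
      simp only [e1, leib, sub1, cs, smul_sub, Finset.sum_sub_distrib]
      simp only [smul_comm _ f]
      abel
    rw [differentialFun, differentialFun, h3, Fin.sum_univ_succ (n := m + 1),
      Fin.sum_univ_succ (n := m + 1), smul_add,
      smul_add]
    simp only [consz, rem, cs, D.nabla_smul_left, D.nabla_smul_right, Matrix.cons_val_zero,
      Matrix.cons_val_succ, Fin.val_zero, pow_zero, one_smul, Fin.val_succ, pow_succ, mul_neg,
      mul_one, neg_smul, smul_add, Finset.sum_add_distrib, Finset.smul_sum, smul_neg,
      Finset.sum_neg_distrib]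
    simp only [smul_comm _ f]
    abel

/-- The Lie algebroid differential from `n`-forms to `(n+1)`-forms with values in `N`. -/
def differential [CharZero 𝕂] {A : LieRinehartStr 𝕂 R L} (D : A.Connection N) (n : ℕ) :
    (L [⋀^Fin n]→ₗ[R] N) →ₗ[𝕂] (L [⋀^Fin (n + 1)]→ₗ[R] N) where
  toFun ω :=
    { toFun := differentialFun D ω
      map_update_add' := by
        intro _ v i x y
        simp only [← differentialAux_apply, AlternatingMap.map_update_add]
      map_update_smul' := by
        intro inst v i f x
        obtain rfl : inst = instDecidableEqFin (n + 1) := Subsingleton.elim _ _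
        have h : ∀ y, Function.update v i y = i.insertNth y (i.removeNth v) := by
          intro y; simp
        rw [h, h, ← differentialAux_apply, ← differentialAux_apply,
          AlternatingMap.map_insertNth, AlternatingMap.map_insertNth, differentialAux_apply,
          differentialAux_apply, differentialFun_cons_smul, smul_comm]
      map_eq_zero_of_eq' := by
        intro v i j h hij
        simp only [← differentialAux_apply]
        exact AlternatingMap.map_eq_zero_of_eq _ v h hij }
  map_add' := by
    intro ω ω'
    ext v
    change differentialFun D (ω + ω') v = differentialFun D ω v + differentialFun D ω' v
    have hb : A.bracketTerm (ω + ω') v = A.bracketTerm ω v + A.bracketTerm ω' v := by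
      cases n with
      | zero => simp [bracketTerm]
      | succ m =>
        simp only [bracketTerm, AlternatingMap.add_apply, smul_add, Finset.sum_add_distrib]
        abel
    simp only [differentialFun, hb, AlternatingMap.add_apply, map_add, smul_add,
      Finset.sum_add_distrib]
    abel
  map_smul' := by
    intro c ω
    ext v
    change differentialFun D (c • ω) v = c • differentialFun D ω v
    have hb : A.bracketTerm (c • ω) v = c • A.bracketTerm ω v := by
      cases n with
      | zero => simp [bracketTerm]
      | succ m =>
        simp only [bracketTerm, AlternatingMap.smul_apply, Finset.smul_sum, smul_neg]
        refine congrArg Neg.neg (Finset.sum_congr rfl fun i _ => Finset.sum_congr rfl fun j _ => ?_)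
        rw [smul_comm]
    simp only [differentialFun, hb, AlternatingMap.smul_apply, map_smul, smul_add,
      Finset.smul_sum]
    refine congrArg (· + _) (Finset.sum_congr rfl fun i _ => ?_)
    rw [smul_comm]

/-- Exchanging the two groups of arguments -/
def flipForm {k l : ℕ} :
    (L [⋀^Fin k]→ₗ[R] (P [⋀^Fin l]→ₗ[R] N)) →ₗ[𝕂] (P [⋀^Fin l]→ₗ[R] (L [⋀^Fin k]→ₗ[R] N)) where
  toFun ω :=
    { toFun := fun w =>
        { toFun := fun v => ω v w
          map_update_add' := by intro _ v i x y; simp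
          map_update_smul' := by intro _ v i x y; simp
          map_eq_zero_of_eq' := by
            intro v i j h hij
            rw [ω.map_eq_zero_of_eq v h hij]; rfl }
      map_update_add' := by
        intro _ v i x y; ext w; simp
      map_update_smul' := by
        intro _ v i x y; ext w; simp
      map_eq_zero_of_eq' := by
        intro v i j h hij
        ext w
        exact (ω w).map_eq_zero_of_eq v h hij }
  map_add' := fun _ _ => rfl
  map_smul' := fun _ _ => rfl

end LieRinehartStr

/-! ## Matched pairs and the double complex -/

namespace LieRinehartStr

variable {𝕂 R L P Q : Type*} [Field 𝕂] [CommRing R] [Algebra 𝕂 R]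
  [AddCommGroup L] [Module R L] [Module 𝕂 L] [IsScalarTower 𝕂 R L]
  [AddCommGroup P] [Module R P] [Module 𝕂 P] [IsScalarTower 𝕂 R P]
  [AddCommGroup Q] [Module R Q] [Module 𝕂 Q] [IsScalarTower 𝕂 R Q]

/-- The matched pair identities for `A` and `B` acting on each other by `∇`. -/
structure IsMatchedPair (A : LieRinehartStr 𝕂 R L) (B : LieRinehartStr 𝕂 R P)
    (DA : A.Representation P) (DB : B.Representation L) : Prop where
  anchor_lie : ∀ (X : L) (Y : P),
    ⁅A.anchor X, B.anchor Y⁆ = - A.anchor (DB.nabla Y X) + B.anchor (DA.nabla X Y)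
  nabla_bracket_right : ∀ (X : L) (Y₁ Y₂ : P),
    DA.nabla X (B.bracket Y₁ Y₂) =
      B.bracket (DA.nabla X Y₁) Y₂ + B.bracket Y₁ (DA.nabla X Y₂) +
        DA.nabla (DB.nabla Y₂ X) Y₁ - DA.nabla (DB.nabla Y₁ X) Y₂
  nabla_bracket_left : ∀ (Y : P) (X₁ X₂ : L),
    DB.nabla Y (A.bracket X₁ X₂) =
      A.bracket (DB.nabla Y X₁) X₂ + A.bracket X₁ (DB.nabla Y X₂) +
        DB.nabla (DA.nabla X₂ Y) X₁ - DB.nabla (DA.nabla X₁ Y) X₂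

variable (R L P) in
/-- The space of `(k, l)`-cochains. When `L` and `P` are the modules of sections of vector bundles
`A` and `B` and `R` is the ring of smooth functions this is the space of sections
of `∧ᵏ A* ⊗ ∧ˡ B*`, a section being identified with the `R`-multilinear form
`α(X₁,…,X_k,Y₁,…,Y_l)`, alternating in the `Xᵢ` and in the `Yⱼ`, that it defines;
this form is `α X Y` below. -/
abbrev BiForm (k l : ℕ) : Type _ := L [⋀^Fin k]→ₗ[R] (P [⋀^Fin l]→ₗ[R] R)

/-- `∂_A`: the differential of `A` with values in `∧ˡ B*`. -/
def partialA [CharZero 𝕂] {A : LieRinehartStr 𝕂 R L} (DA : A.Connection P) (k l : ℕ) :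
    BiForm R L P k l →ₗ[𝕂] BiForm R L P (k + 1) l :=
  differential (DA.exteriorDual l) k

/-- `∂_B`: the differential of `B` with values in `∧ᵏ A*`. -/
def partialB [CharZero 𝕂] {B : LieRinehartStr 𝕂 R P} (DB : B.Connection L) (k l : ℕ) :
    BiForm R L P k l →ₗ[𝕂] BiForm R L P k (l + 1) :=
  flipForm ∘ₗ differential (DB.exteriorDual k) l ∘ₗ flipForm

theorem partialA_apply [CharZero 𝕂] {A : LieRinehartStr 𝕂 R L} (DA : A.Connection P) (k l : ℕ)
    (α : BiForm R L P k l) (X : Fin (k + 1) → L) (Y : Fin l → P) :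
    partialA DA k l α X Y =
      ∑ i : Fin (k + 1), (-1 : ℤ) ^ (i : ℕ) •
        (A.anchor (X i) (α (i.removeNth X) Y) -
          ∑ j, α (i.removeNth X) (Function.update Y j (DA.nabla (X i) (Y j)))) +
      A.bracketTerm α X Y := by
  have h : partialA DA k l α X Y =
      (∑ i : Fin (k + 1), (-1 : ℤ) ^ (i : ℕ) •
        (DA.exteriorDual l).nabla (X i) (α (i.removeNth X)) + A.bracketTerm α X) Y := rfl
  let ev : (P [⋀^Fin l]→ₗ[R] R) →+ R :=
    { toFun := fun β => β Y, map_zero' := rfl, map_add' := fun _ _ => rfl }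
  rw [h]
  change ev (_ + _) = _
  rw [map_add, map_sum]
  refine congrArg (· + _) (Finset.sum_congr rfl fun i _ => ?_)
  rw [map_zsmul]
  rfl

theorem partialB_apply [CharZero 𝕂] {B : LieRinehartStr 𝕂 R P} (DB : B.Connection L) (k l : ℕ)
    (α : BiForm R L P k l) (X : Fin k → L) (Y : Fin (l + 1) → P) :
    partialB DB k l α X Y =
      ∑ i : Fin (l + 1), (-1 : ℤ) ^ (i : ℕ) •
        (B.anchor (Y i) (α X (i.removeNth Y)) -
          ∑ j, α (Function.update X j (DB.nabla (Y i) (X j))) (i.removeNth Y)) +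
      B.bracketTerm (flipForm (𝕂 := 𝕂) α) Y X :=
  partialA_apply DB l k (flipForm (𝕂 := 𝕂) α) Y X

variable (R L P) in
/-- The degree `n` part `⨁_{k+l=n} ∧ᵏ A* ⊗ ∧ˡ B*` of the total complex. -/
abbrev TotalForm (n : ℕ) : Type _ :=
  ∀ p : {p : ℕ × ℕ // p.1 + p.2 = n}, BiForm R L P p.1.1 p.1.2

/-- The `(k, l)`-component of `∂_A α`. -/
def totalPartialA [CharZero 𝕂] {A : LieRinehartStr 𝕂 R L} (DA : A.Connection P) (n : ℕ) :
    ∀ p : {p : ℕ × ℕ // p.1 + p.2 = n + 1}, TotalForm R L P n →ₗ[𝕂] BiForm R L P p.1.1 p.1.2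
  | ⟨(0, _), _⟩ => 0
  | ⟨(k + 1, l), h⟩ => partialA DA k l ∘ₗ
      LinearMap.proj (⟨(k, l), by simp only at h ⊢; omega⟩ : {p : ℕ × ℕ // p.1 + p.2 = n})

/-- The `(k, l)`-component of `(-1)ᵏ ∂_B α`. -/
def totalPartialB [CharZero 𝕂] {B : LieRinehartStr 𝕂 R P} (DB : B.Connection L) (n : ℕ) :
    ∀ p : {p : ℕ × ℕ // p.1 + p.2 = n + 1}, TotalForm R L P n →ₗ[𝕂] BiForm R L P p.1.1 p.1.2
  | ⟨(_, 0), _⟩ => 0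
  | ⟨(k, l + 1), h⟩ => (-1 : ℤ) ^ k • (partialB DB k l ∘ₗ
      LinearMap.proj (⟨(k, l), by simp only at h ⊢; omega⟩ : {p : ℕ × ℕ // p.1 + p.2 = n}))

/-- The total differential, equal to `∂_A + (-1)ᵏ ∂_B` on `(k, l)`-cochains. -/
def totalDifferential [CharZero 𝕂] {A : LieRinehartStr 𝕂 R L} {B : LieRinehartStr 𝕂 R P}
    (DA : A.Connection P) (DB : B.Connection L) (n : ℕ) :
    TotalForm R L P n →ₗ[𝕂] TotalForm R L P (n + 1) :=
  LinearMap.pi fun p => totalPartialA DA n p + totalPartialB DB n p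

theorem append_update_left {k l n : ℕ} (h : k + l = n) (u : Fin k → Q) (v : Fin l → Q)
    (a : Fin k) (x : Q) :
    Fin.append (Function.update u a x) v ∘ Fin.cast h.symm =
      Function.update (Fin.append u v ∘ Fin.cast h.symm) (Fin.cast h (Fin.castAdd l a)) x := by
  subst h
  funext b
  refine Fin.addCases (fun b => ?_) (fun b => ?_) b
  · by_cases hb : b = a
    · subst hb; simp
    · simp [Function.update_of_ne, hb]
  · have : Fin.natAdd k b ≠ Fin.castAdd l a := by
      intro hh
      have := congrArg Fin.val hh
      simp at this
      omega
    simp [Function.update_of_ne, this]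

theorem append_update_right {k l n : ℕ} (h : k + l = n) (u : Fin k → Q) (v : Fin l → Q)
    (a : Fin l) (x : Q) :
    Fin.append u (Function.update v a x) ∘ Fin.cast h.symm =
      Function.update (Fin.append u v ∘ Fin.cast h.symm) (Fin.cast h (Fin.natAdd k a)) x := by
  subst h
  funext b
  refine Fin.addCases (fun b => ?_) (fun b => ?_) b
  · have : Fin.castAdd l b ≠ Fin.natAdd k a := by
      intro hh
      have := congrArg Fin.val hh
      simp at this
      omega
    simp [Function.update_of_ne, this]
  · by_cases hb : b = a
    · subst hb; simp
    · simp [Function.update_of_ne, hb]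

/-- The form `(X₁,…,X_k,Y₁,…,Y_l) ↦ ω(iX₁,…,iX_k,jY₁,…,jY_l)`. -/
def restrictBiForm (i : L →ₗ[R] Q) (j : P →ₗ[R] Q) {k l n : ℕ} (h : k + l = n) :
    (Q [⋀^Fin n]→ₗ[R] R) →ₗ[𝕂] BiForm R L P k l where
  toFun ω :=
    { toFun := fun X =>
        { toFun := fun Y =>
            ω (Fin.append (i ∘ X) (j ∘ Y) ∘ Fin.cast h.symm)
          map_update_add' := by
            intro inst Y a x y
            obtain rfl : inst = instDecidableEqFin l := Subsingleton.elim _ _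
            simp only [Function.comp_update, append_update_right h, map_add,
              AlternatingMap.map_update_add]
          map_update_smul' := by
            intro inst Y a c x
            obtain rfl : inst = instDecidableEqFin l := Subsingleton.elim _ _
            simp only [Function.comp_update, append_update_right h, map_smul,
              AlternatingMap.map_update_smul]
          map_eq_zero_of_eq' := by
            intro Y p q hY hpq
            refine ω.map_eq_zero_of_eq _ (i := Fin.cast h (Fin.natAdd k p))
              (j := Fin.cast h (Fin.natAdd k q)) ?_ ?_
            · simp [hY]
            · simpa using hpq }
      map_update_add' := by
        intro inst X a x y
        obtain rfl : inst = instDecidableEqFin k := Subsingleton.elim _ _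
        ext Y
        simp only [AlternatingMap.add_apply, AlternatingMap.coe_mk, MultilinearMap.coe_mk,
          Function.comp_update, append_update_left h, map_add, AlternatingMap.map_update_add]
      map_update_smul' := by
        intro inst X a c x
        obtain rfl : inst = instDecidableEqFin k := Subsingleton.elim _ _
        ext Y
        simp only [AlternatingMap.smul_apply, AlternatingMap.coe_mk, MultilinearMap.coe_mk,
          Function.comp_update, append_update_left h, map_smul, AlternatingMap.map_update_smul]
      map_eq_zero_of_eq' := by
        intro X p q hX hpq
        ext Y
        refine ω.map_eq_zero_of_eq _ (i := Fin.cast h (Fin.castAdd l p))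
          (j := Fin.cast h (Fin.castAdd l q)) ?_ ?_
        · simp [hX]
        · simpa using hpq }
  map_add' := fun _ _ => rfl
  map_smul' := fun _ _ => rfl

/-- The family of all components of the restriction of an `n`-form on `A ⊕ B`. -/
def restrictTotal (i : L →ₗ[R] Q) (j : P →ₗ[R] Q) (n : ℕ) :
    (Q [⋀^Fin n]→ₗ[R] R) →ₗ[𝕂] TotalForm R L P n :=
  LinearMap.pi fun p => restrictBiForm i j p.2

end LieRinehartStr

section Cohomology

variable {𝕂 : Type*} [Field 𝕂] {C : ℕ → Type*} [∀ n, AddCommGroup (C n)] [∀ n, Module 𝕂 (C n)]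

/-- The coboundaries of a cochain complex. -/
def coboundaries (d : ∀ n, C n →ₗ[𝕂] C (n + 1)) : ∀ n, Submodule 𝕂 (C n)
  | 0 => ⊥
  | n + 1 => LinearMap.range (d n)

/-- The `n`-th cohomology `ker dₙ / im dₙ₋₁` of a cochain complex. -/
abbrev Cohomology (d : ∀ n, C n →ₗ[𝕂] C (n + 1)) (n : ℕ) : Type _ :=
  LinearMap.ker (d n) ⧸ (coboundaries d n).submoduleOf (LinearMap.ker (d n))

/-- `f` is a morphism of cochain complexes and induces isomorphisms in cohomology. -/
def InducesCohomologyIso {C' : ℕ → Type*} [∀ n, AddCommGroup (C' n)] [∀ n, Module 𝕂 (C' n)]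
    (d : ∀ n, C n →ₗ[𝕂] C (n + 1)) (d' : ∀ n, C' n →ₗ[𝕂] C' (n + 1))
    (f : ∀ n, C n →ₗ[𝕂] C' n) : Prop :=
  (∀ n, d' n ∘ₗ f n = f (n + 1) ∘ₗ d n) ∧
  ∀ n, ∃ Φ : Cohomology d n ≃ₗ[𝕂] Cohomology d' n,
    ∀ z : LinearMap.ker (d n), ∃ h : f n z ∈ LinearMap.ker (d' n),
      Φ (Submodule.Quotient.mk z) = Submodule.Quotient.mk ⟨f n z, h⟩

end Cohomology

/-! ## Smooth `𝕂`-vector bundles and Lie algebroids -/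

open Bundle
open scoped Manifold ContDiff TensorProduct

section Smooth

variable (𝕂 : Type*) [RCLike 𝕂] {E : Type*} [NormedAddCommGroup E] [NormedSpace ℝ E]
  (M : Type*) [TopologicalSpace M] [ChartedSpace E M]

instance instContMDiffRingRCLike : ContMDiffRing 𝓘(ℝ, 𝕂) ∞ 𝕂 :=
  { (inferInstance : LieAddGroup 𝓘(ℝ, 𝕂) ∞ 𝕂) with
    contMDiff_mul := by
      rw [contMDiff_iff]
      refine ⟨continuous_mul, fun x y => ?_⟩
      simp only [mfld_simps, chartAt_self_eq]
      rw [contDiffOn_univ]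
      exact contDiff_mul }

variable (E) in
/-- The ring `C^∞(M, 𝕂)` of smooth `𝕂`-valued functions on `M`. -/
abbrev SmoothFn : Type _ := C^∞⟮𝓘(ℝ, E), M; 𝓘(ℝ, 𝕂), 𝕂⟯

noncomputable instance instAlgebraSmoothFn : Algebra 𝕂 (SmoothFn 𝕂 E M) :=
  RingHom.toAlgebra
    { toFun := fun c => ⟨fun _ => c, contMDiff_const⟩
      map_one' := rfl
      map_mul' := fun _ _ => rfl
      map_zero' := rfl
      map_add' := fun _ _ => rfl }

variable {𝕂 M}
variable {F : Type*} [NormedAddCommGroup F] [NormedSpace ℝ F] [NormedSpace 𝕂 F]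
  [IsScalarTower ℝ 𝕂 F]
  {V : M → Type*} [TopologicalSpace (TotalSpace F V)] [∀ x, TopologicalSpace (V x)]
  [∀ x, AddCommGroup (V x)] [∀ x, Module ℝ (V x)] [∀ x, Module 𝕂 (V x)]
  [FiberBundle F V] [VectorBundle ℝ F V] [VectorBundle 𝕂 F V]

theorem contMDiff_smul_section {f : M → 𝕂} {s : ∀ x, V x}
    (hf : ContMDiff 𝓘(ℝ, E) 𝓘(ℝ, 𝕂) ∞ f)
    (hs : ContMDiff 𝓘(ℝ, E) (𝓘(ℝ, E).prod 𝓘(ℝ, F)) ∞ fun x => TotalSpace.mk' F x (s x)) :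
    ContMDiff 𝓘(ℝ, E) (𝓘(ℝ, E).prod 𝓘(ℝ, F)) ∞ fun x => TotalSpace.mk' F x (f x • s x) := by
  intro x₀
  have hs₀ := hs x₀
  rw [contMDiffAt_section] at hs₀ ⊢
  set e := trivializationAt F V x₀
  have hsm : ContDiff ℝ ∞ fun p : 𝕂 × F => p.1 • p.2 := contDiff_smul
  have := hsm.contMDiff.contMDiffAt.comp x₀ ((hf x₀).prodMk_space hs₀)
  refine this.congr_of_eventuallyEq ?_
  filter_upwards [e.open_baseSet.mem_nhds (mem_baseSet_trivializationAt F V x₀)] with x hx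
  exact (e.linear 𝕂 hx).2 _ _

/-- Smooth sections form a module over `C^∞(M, 𝕂)`. -/
noncomputable instance instModuleSmoothFnSection :
    Module (SmoothFn 𝕂 E M) Cₛ^∞⟮𝓘(ℝ, E); F, V⟯ where
  smul f s := ⟨fun x => f x • s x, contMDiff_smul_section f.contMDiff s.contMDiff⟩
  one_smul s := by ext x; exact one_smul 𝕂 (s x)
  mul_smul f g s := by ext x; exact mul_smul (f x) (g x) (s x)
  smul_zero f := by ext x; exact smul_zero (f x)
  smul_add f s t := by ext x; exact smul_add (f x) (s x) (t x)
  add_smul f g s := by ext x; exact add_smul (f x) (g x) (s x)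
  zero_smul s := by ext x; exact zero_smul 𝕂 (s x)

noncomputable instance instModuleSection : Module 𝕂 Cₛ^∞⟮𝓘(ℝ, E); F, V⟯ :=
  Module.compHom _ (algebraMap 𝕂 (SmoothFn 𝕂 E M))

instance : IsScalarTower 𝕂 (SmoothFn 𝕂 E M) Cₛ^∞⟮𝓘(ℝ, E); F, V⟯ :=
  ⟨fun c f s => by
    rw [Algebra.smul_def, mul_smul]; rfl⟩



/-- The smooth function given by `f`. -/
def SmoothFn.of (f : M → 𝕂) (hf : ContMDiff 𝓘(ℝ, E) 𝓘(ℝ, 𝕂) ∞ f) : SmoothFn 𝕂 E M := ⟨f, hf⟩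

/-- The differential `df_x : T_x M → 𝕂` of a smooth function. -/
noncomputable def SmoothFn.diff (f : SmoothFn 𝕂 E M) (x : M) :
    TangentSpace 𝓘(ℝ, E) x →ₗ[ℝ] 𝕂 :=
  (mfderiv 𝓘(ℝ, E) 𝓘(ℝ, 𝕂) f x).toLinearMap

/-- The derivative of `f ∈ C^∞(M, 𝕂)` along a `𝕂`-valued tangent vector `v ∈ 𝕂 ⊗ T_x M`:
the `𝕂`-linear extension of `df_x`. -/
noncomputable def tangentDeriv (f : SmoothFn 𝕂 E M) (x : M) :
    (𝕂 ⊗[ℝ] TangentSpace 𝓘(ℝ, E) x) →ₗ[𝕂] 𝕂 :=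
  (f.diff x).liftBaseChange 𝕂

theorem SmoothFn.hasMFDerivAt (f : SmoothFn 𝕂 E M) (x : M) :
    HasMFDerivAt 𝓘(ℝ, E) 𝓘(ℝ, 𝕂) f x (mfderiv 𝓘(ℝ, E) 𝓘(ℝ, 𝕂) f x) :=
  (f.contMDiff.mdifferentiable (by simp) x).hasMFDerivAt

theorem tangentDeriv_add_fn (f g : SmoothFn 𝕂 E M) (x : M)
    (v : 𝕂 ⊗[ℝ] TangentSpace 𝓘(ℝ, E) x) :
    tangentDeriv (f + g) x v = tangentDeriv f x v + tangentDeriv g x v := by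
  have h : ∀ t, (f + g).diff x t = f.diff x t + g.diff x t := fun t =>
    congrArg (fun l => l t) ((f.hasMFDerivAt x).add (g.hasMFDerivAt x)).mfderiv
  induction v with
  | zero => simp
  | add v w hv hw => simp only [map_add, hv, hw]; ring
  | tmul c t =>
    simp only [tangentDeriv, LinearMap.liftBaseChange_tmul, h, smul_eq_mul]
    ring

theorem tangentDeriv_mul_fn (f g : SmoothFn 𝕂 E M) (x : M)
    (v : 𝕂 ⊗[ℝ] TangentSpace 𝓘(ℝ, E) x) :
    tangentDeriv (f * g) x v = f x * tangentDeriv g x v + g x * tangentDeriv f x v := by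
  have h : ∀ t, (f * g).diff x t = f x * g.diff x t + g x * f.diff x t := fun t =>
    congrArg (fun l => l t) ((f.hasMFDerivAt x).mul (g.hasMFDerivAt x)).mfderiv
  induction v with
  | zero => simp
  | add v w hv hw => simp only [map_add, hv, hw]; ring
  | tmul c t =>
    simp only [tangentDeriv, LinearMap.liftBaseChange_tmul, h, smul_eq_mul]
    ring

theorem tangentDeriv_const (c : 𝕂) (x : M) (v : 𝕂 ⊗[ℝ] TangentSpace 𝓘(ℝ, E) x) :
    tangentDeriv (algebraMap 𝕂 (SmoothFn 𝕂 E M) c) x v = 0 := by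
  have h : ∀ t, (algebraMap 𝕂 (SmoothFn 𝕂 E M) c).diff x t = 0 := fun t =>
    congrArg (fun l => l t) (mfderiv_const (I := 𝓘(ℝ, E)) (I' := 𝓘(ℝ, 𝕂)) (c := c) (x := x))
  induction v with
  | zero => simp
  | add v w hv hw => simp only [map_add, hv, hw]; ring
  | tmul a t =>
    simp only [tangentDeriv, LinearMap.liftBaseChange_tmul, h, smul_zero]

variable (𝕂 E F V) in
/-- A (real if `𝕂 = ℝ`, complex if `𝕂 = ℂ`) Lie algebroid structure on the smooth `𝕂`-vector bundle
`V → M`: a bundle map `V → TM ⊗ 𝕂` (the anchor) and a `𝕂`-Lie bracket on smooth sections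
satisfying the Leibniz rule, such that the anchor is a morphism for the brackets. Vector fields are
compared through their action on smooth functions. -/
structure LieAlgebroid where
  /-- the anchor -/
  anchor : ∀ x, V x →ₗ[𝕂] 𝕂 ⊗[ℝ] TangentSpace 𝓘(ℝ, E) x
  /-- the anchor is smooth: it sends smooth sections to smooth vector fields -/
  contMDiff_anchor : ∀ (X : Cₛ^∞⟮𝓘(ℝ, E); F, V⟯) (f : SmoothFn 𝕂 E M),
    ContMDiff 𝓘(ℝ, E) 𝓘(ℝ, 𝕂) ∞ fun x => tangentDeriv f x (anchor x (X x))
  /-- the bracket -/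
  bracket : Cₛ^∞⟮𝓘(ℝ, E); F, V⟯ →ₗ[𝕂] Cₛ^∞⟮𝓘(ℝ, E); F, V⟯ →ₗ[𝕂] Cₛ^∞⟮𝓘(ℝ, E); F, V⟯
  bracket_self : ∀ X, bracket X X = 0
  jacobi : ∀ X Y Z, bracket X (bracket Y Z) = bracket (bracket X Y) Z + bracket Y (bracket X Z)
  leibniz : ∀ (X Y : Cₛ^∞⟮𝓘(ℝ, E); F, V⟯) (f : SmoothFn 𝕂 E M),
    bracket X (f • Y) = f • bracket X Y +
      SmoothFn.of (fun x => tangentDeriv f x (anchor x (X x))) (contMDiff_anchor X f) • Y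
  anchor_bracket : ∀ (X Y : Cₛ^∞⟮𝓘(ℝ, E); F, V⟯) (f : SmoothFn 𝕂 E M) (x : M),
    tangentDeriv f x (anchor x (bracket X Y x)) =
      tangentDeriv (SmoothFn.of (fun y => tangentDeriv f y (anchor y (Y y))) (contMDiff_anchor Y f)) x
        (anchor x (X x)) -
      tangentDeriv (SmoothFn.of (fun y => tangentDeriv f y (anchor y (X y))) (contMDiff_anchor X f)) x
        (anchor x (Y x))

/-- The algebraic structure on the sections of a Lie algebroid. -/
noncomputable def LieAlgebroid.toStr (A : LieAlgebroid 𝕂 E F V) :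
    LieRinehartStr 𝕂 (SmoothFn 𝕂 E M) Cₛ^∞⟮𝓘(ℝ, E); F, V⟯ where
  bracket := A.bracket
  anchor :=
    { toFun := fun X => Derivation.mk'
        { toFun := fun f =>
            SmoothFn.of (fun x => tangentDeriv f x (A.anchor x (X x))) (A.contMDiff_anchor X f)
          map_add' := fun f g => by ext x; exact tangentDeriv_add_fn f g x _
          map_smul' := fun c f => by
            ext x
            change tangentDeriv (c • f) x (A.anchor x (X x)) =
              c * tangentDeriv f x (A.anchor x (X x))
            rw [Algebra.smul_def, tangentDeriv_mul_fn, tangentDeriv_const, mul_zero, add_zero]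
            rfl }
        (fun f g => by ext x; exact tangentDeriv_mul_fn f g x _)
      map_add' := fun X Y => by
        ext f x
        change tangentDeriv f x (A.anchor x (X x + Y x)) = tangentDeriv f x (A.anchor x (X x)) +
          tangentDeriv f x (A.anchor x (Y x))
        rw [map_add, map_add]
      map_smul' := fun g X => by
        ext f x
        change tangentDeriv f x (A.anchor x (g x • X x)) =
          g x * tangentDeriv f x (A.anchor x (X x))
        rw [map_smul, map_smul, smul_eq_mul] }
  bracket_self := A.bracket_self
  jacobi := A.jacobi
  anchor_bracket X Y := by
    ext f x
    rw [Derivation.commutator_apply]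
    exact A.anchor_bracket X Y f x
  leibniz X f Y := A.leibniz X Y f

/-- The Lie algebroid differential (with trivial coefficients) on sections of `∧ⁿ V*`. -/
noncomputable def LieAlgebroid.differential (C : LieAlgebroid 𝕂 E F V) (n : ℕ) :
    (Cₛ^∞⟮𝓘(ℝ, E); F, V⟯ [⋀^Fin n]→ₗ[SmoothFn 𝕂 E M] SmoothFn 𝕂 E M) →ₗ[𝕂]
      (Cₛ^∞⟮𝓘(ℝ, E); F, V⟯ [⋀^Fin (n + 1)]→ₗ[SmoothFn 𝕂 E M] SmoothFn 𝕂 E M) :=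
  LieRinehartStr.differential C.toStr.trivialRep.toConnection n

end Smooth

/-! ## The direct sum bundle -/

section DirectSum

variable {𝕂 : Type*} [RCLike 𝕂] {E : Type*} [NormedAddCommGroup E] [NormedSpace ℝ E]
  {M : Type*} [TopologicalSpace M] [ChartedSpace E M]
  {F₁ : Type*} [NormedAddCommGroup F₁] [NormedSpace ℝ F₁] [NormedSpace 𝕂 F₁]
  [IsScalarTower ℝ 𝕂 F₁]
  {A : M → Type*} [TopologicalSpace (TotalSpace F₁ A)] [∀ x, TopologicalSpace (A x)]
  [∀ x, AddCommGroup (A x)] [∀ x, Module ℝ (A x)] [∀ x, Module 𝕂 (A x)]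
  [FiberBundle F₁ A] [VectorBundle ℝ F₁ A] [VectorBundle 𝕂 F₁ A]
  {F₂ : Type*} [NormedAddCommGroup F₂] [NormedSpace ℝ F₂] [NormedSpace 𝕂 F₂]
  [IsScalarTower ℝ 𝕂 F₂]
  {B : M → Type*} [TopologicalSpace (TotalSpace F₂ B)] [∀ x, TopologicalSpace (B x)]
  [∀ x, AddCommGroup (B x)] [∀ x, Module ℝ (B x)] [∀ x, Module 𝕂 (B x)]
  [FiberBundle F₂ B] [VectorBundle ℝ F₂ B] [VectorBundle 𝕂 F₂ B]

theorem contMDiff_prod_section {s : ∀ x, A x} {t : ∀ x, B x}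
    (hs : ContMDiff 𝓘(ℝ, E) (𝓘(ℝ, E).prod 𝓘(ℝ, F₁)) ∞ fun x => TotalSpace.mk' F₁ x (s x))
    (ht : ContMDiff 𝓘(ℝ, E) (𝓘(ℝ, E).prod 𝓘(ℝ, F₂)) ∞ fun x => TotalSpace.mk' F₂ x (t x)) :
    ContMDiff 𝓘(ℝ, E) (𝓘(ℝ, E).prod 𝓘(ℝ, F₁ × F₂)) ∞
      fun x => TotalSpace.mk' (F₁ × F₂) (E := A ×ᵇ B) x (s x, t x) := by
  intro x₀
  have hs₀ := hs x₀
  have ht₀ := ht x₀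
  rw [contMDiffAt_section] at hs₀ ht₀ ⊢
  exact hs₀.prodMk_space ht₀

/-- The section `X ⊕ Y` of `A ⊕ B`. -/
noncomputable def sectionSum (X : Cₛ^∞⟮𝓘(ℝ, E); F₁, A⟯) (Y : Cₛ^∞⟮𝓘(ℝ, E); F₂, B⟯) :
    Cₛ^∞⟮𝓘(ℝ, E); F₁ × F₂, A ×ᵇ B⟯ :=
  ⟨fun x => (X x, Y x), contMDiff_prod_section X.contMDiff Y.contMDiff⟩

variable (𝕂 E F₁ A F₂ B) in
/-- `X ↦ X ⊕ 0`. -/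
noncomputable def sectionInl :
    Cₛ^∞⟮𝓘(ℝ, E); F₁, A⟯ →ₗ[SmoothFn 𝕂 E M] Cₛ^∞⟮𝓘(ℝ, E); F₁ × F₂, A ×ᵇ B⟯ where
  toFun X := sectionSum X 0
  map_add' X Y := by
    ext x : 1
    exact Prod.ext rfl (add_zero (0 : B x)).symm
  map_smul' f X := by
    ext x : 1
    exact Prod.ext rfl (smul_zero (f x)).symm

variable (𝕂 E F₁ A F₂ B) in
/-- `Y ↦ 0 ⊕ Y`. -/
noncomputable def sectionInr :
    Cₛ^∞⟮𝓘(ℝ, E); F₂, B⟯ →ₗ[SmoothFn 𝕂 E M] Cₛ^∞⟮𝓘(ℝ, E); F₁ × F₂, A ×ᵇ B⟯ where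
  toFun Y := sectionSum 0 Y
  map_add' X Y := by
    ext x : 1
    exact Prod.ext (add_zero (0 : A x)).symm rfl
  map_smul' f X := by
    ext x : 1
    exact Prod.ext (smul_zero (f x)).symm rfl

/-- `C` is the Lie algebroid structure `A ⋈ B` on the bundle `A ⊕ B`. -/
structure IsBowtie (LA : LieAlgebroid 𝕂 E F₁ A) (LB : LieAlgebroid 𝕂 E F₂ B)
    (DA : LA.toStr.Representation Cₛ^∞⟮𝓘(ℝ, E); F₂, B⟯)
    (DB : LB.toStr.Representation Cₛ^∞⟮𝓘(ℝ, E); F₁, A⟯)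
    (C : LieAlgebroid 𝕂 E (F₁ × F₂) (A ×ᵇ B)) : Prop where
  anchor_eq : ∀ (x : M) (u : A x) (v : B x), C.anchor x (u, v) = LA.anchor x u + LB.anchor x v
  bracket_eq : ∀ (X₁ X₂ : Cₛ^∞⟮𝓘(ℝ, E); F₁, A⟯) (Y₁ Y₂ : Cₛ^∞⟮𝓘(ℝ, E); F₂, B⟯),
    C.bracket (sectionSum X₁ Y₁) (sectionSum X₂ Y₂) =
      sectionSum
        (LA.bracket X₁ X₂ + DB.nabla Y₁ X₂ - DB.nabla Y₂ X₁)
        (LB.bracket Y₁ Y₂ + DA.nabla X₁ Y₂ - DA.nabla X₂ Y₁)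

end DirectSum

open LieRinehartStr

/-! ## Cartan calculus for Lie–Rinehart algebras -/

namespace LieRinehartStr

variable {𝕂 R L N P Q : Type*} [Field 𝕂] [CommRing R] [Algebra 𝕂 R]
  [AddCommGroup L] [Module R L] [Module 𝕂 L] [IsScalarTower 𝕂 R L]
  [AddCommGroup N] [Module R N] [Module 𝕂 N] [IsScalarTower 𝕂 R N]
  [AddCommGroup P] [Module R P] [Module 𝕂 P] [IsScalarTower 𝕂 R P]

/-! Everything is done on modules of sections by Cartan calculus. Two alternating forms agree once
all their contractions agree (`AlternatingMap.ext_curryLeft`), so identities between operators on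
forms are proved by induction on the degree, contracting one argument at a time. Cartan's formula
`differential_curryLeft` and the commutator rule for Lie derivatives give `𝓛_X d = d 𝓛_X`, and then
`d² = 0` for every representation. Applied to the representations induced on exterior powers of the
dual, this is part 1.

For a matched pair, the sum of the two section modules is a Lie–Rinehart algebra
(`IsMatchedPair.bowtie`): its Jacobi identity splits into the two Jacobi identities, the two
flatness conditions and the two bracket identities. Restricting forms on the sum to `k` arguments in
`A` and `l` in `B` intertwines `d` with `∂_A + (-1)ᵏ ∂_B` (`restrictTotal_differential`), and it is
bijective because the sum is direct and `k! l!` is invertible. A bijective chain map induces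
isomorphisms in cohomology.

Neither `D² = 0` for the total differential nor `∂_B ∂_A = ∂_A ∂_B` is computed directly. The first
is transported from `d² = 0` through the surjective restriction map; the second is one component of
`D² = 0`.

Conversely, commutation on functions is exactly the anchor identity. Commutation on a dual element
`φ` of `B` is, given the anchor identity, the first bracket identity paired with `φ`; exchanging `A`
and `B` gives the second. The pairing with `φ` can be removed because bump functions provide enough
duals to separate smooth sections (`exists_dual_ne_zero`). -/

theorem bracket_anti (A : LieRinehartStr 𝕂 R L) (X Y : L) :
    A.bracket Y X = - A.bracket X Y := by
  have := A.bracket_self (X + Y)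
  simp only [map_add, LinearMap.add_apply, A.bracket_self] at this
  rw [zero_add, add_zero] at this
  exact eq_neg_of_add_eq_zero_left this

theorem _root_.AlternatingMap.ext_curryLeft {n : ℕ} {ξ ξ' : L [⋀^Fin (n + 1)]→ₗ[R] N}
    (h : ∀ x, ξ.curryLeft x = ξ'.curryLeft x) : ξ = ξ' := by
  ext v
  have := congrArg (fun η => η (Matrix.vecTail v)) (h (Matrix.vecHead v))
  simpa using this

theorem _root_.AlternatingMap.curryLeft_sub' {n : ℕ} (ξ ξ' : L [⋀^Fin (n + 1)]→ₗ[R] N) (x : L) :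
    (ξ - ξ').curryLeft x = ξ.curryLeft x - ξ'.curryLeft x := rfl

theorem _root_.AlternatingMap.map_update_eq_vecCons {n : ℕ} (ξ : L [⋀^Fin (n + 1)]→ₗ[R] N)
    (v : Fin (n + 1) → L) (j : Fin (n + 1)) (x : L) :
    ξ (Function.update v j x) = (-1 : ℤ) ^ (j : ℕ) • ξ (Matrix.vecCons x (j.removeNth v)) := by
  have h : Function.update v j x = j.insertNth x (j.removeNth v) := by simp
  rw [h, AlternatingMap.map_insertNth]

theorem removeNth_succ_vecCons {m : ℕ} (y : L) (u : Fin (m + 1) → L) (i : Fin (m + 1)) :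
    i.succ.removeNth (Matrix.vecCons y u : Fin (m + 2) → L) =
      (Matrix.vecCons y (i.removeNth u) : Fin (m + 1) → L) := by
  funext j
  refine Fin.cases ?_ (fun j => ?_) j <;> simp [Fin.removeNth_apply]

theorem removeNth_zero_vecCons {m : ℕ} (y : L) (u : Fin m → L) :
    (0 : Fin (m + 1)).removeNth (Matrix.vecCons y u : Fin (m + 1) → L) = u := by
  funext j
  simp [Fin.removeNth_apply]

theorem update_zero_vecCons {m : ℕ} (y z : L) (u : Fin m → L) :
    Function.update (Matrix.vecCons y u) 0 z = Matrix.vecCons z u := by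
  simp [Matrix.vecCons]

theorem update_succ_vecCons {m : ℕ} (y z : L) (u : Fin m → L) (j : Fin m) :
    Function.update (Matrix.vecCons y u) j.succ z = Matrix.vecCons y (Function.update u j z) := by
  simp [Matrix.vecCons]

/-- The derivation `ξ ↦ ν ∘ ξ - ∑ⱼ ξ(…, δ vⱼ, …)` of alternating forms induced by first-order
operators `ν` and `δ` with the same symbol `θ`. -/
def formDeriv (θ : Derivation 𝕂 R R) (ν : N →ₗ[𝕂] N)
    (hν : ∀ (f : R) n, ν (f • n) = f • ν n + θ f • n)
    (δ : L →ₗ[𝕂] L) (hδ : ∀ (f : R) x, δ (f • x) = f • δ x + θ f • x) (n : ℕ) :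
    (L [⋀^Fin n]→ₗ[R] N) →ₗ[𝕂] (L [⋀^Fin n]→ₗ[R] N) where
  toFun ξ :=
    { toFun := fun v => ν (ξ v) - ∑ j, ξ (Function.update v j (δ (v j)))
      map_update_add' := by
        intro inst v i x y
        obtain rfl : inst = instDecidableEqFin n := Subsingleton.elim _ _
        have hc : ∀ {j} (z : L), j ≠ i → Function.update (Function.update v i z) j (δ (v j)) =
            Function.update (Function.update v j (δ (v j))) i z :=
          fun z h => Function.update_comm h.symm _ _ _
        have key : ∀ j, ξ (Function.update (Function.update v i (x + y)) j
              (δ (Function.update v i (x + y) j))) =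
            ξ (Function.update (Function.update v i x) j (δ (Function.update v i x j))) +
            ξ (Function.update (Function.update v i y) j (δ (Function.update v i y j))) := by
          intro j
          by_cases h : j = i
          · subst h
            simp
          · simp only [Function.update_of_ne h, hc _ h,
              AlternatingMap.map_update_add]
        simp only [key, AlternatingMap.map_update_add, map_add, Finset.sum_add_distrib]
        abel
      map_update_smul' := by
        intro inst v i c x
        obtain rfl : inst = instDecidableEqFin n := Subsingleton.elim _ _
        have hc : ∀ {j} (z : L), j ≠ i → Function.update (Function.update v i z) j (δ (v j)) =
            Function.update (Function.update v j (δ (v j))) i z :=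
          fun z h => Function.update_comm h.symm _ _ _
        -- The failure of linearity comes only from the slot `j = i`, with coefficient `θ c`; it
        -- cancels against the symbol of `ν`, which is why both operators must have the same symbol.
        have key : ∀ j, ξ (Function.update (Function.update v i (c • x)) j
              (δ (Function.update v i (c • x) j))) =
            c • ξ (Function.update (Function.update v i x) j (δ (Function.update v i x j))) +
            if j = i then θ c • ξ (Function.update v i x) else 0 := by
          intro j
          by_cases h : j = i
          · subst h
            simp [hδ]
          · simp only [Function.update_of_ne h, hc _ h,
              AlternatingMap.map_update_smul, if_neg h, add_zero]
        simp only [key, AlternatingMap.map_update_smul, Finset.sum_add_distrib,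
          Finset.sum_ite_eq', Finset.mem_univ, if_true, ← Finset.smul_sum, hν, smul_sub]
        abel
      map_eq_zero_of_eq' := by
        intro v p q h hpq
        -- If `v p = v q`, only the summands that alter slot `p` or slot `q` can survive, and these
        -- differ by a transposition, so they cancel.
        rw [ξ.map_eq_zero_of_eq v h hpq, map_zero, zero_sub, neg_eq_zero,
          Fintype.sum_eq_add p q hpq]
        · have hs : Function.update v q (δ (v q)) =
              Function.update v p (δ (v p)) ∘ Equiv.swap p q := by
            funext r
            rcases eq_or_ne r p with rfl | hrp
            · simp [Function.update_of_ne hpq, Function.update_of_ne hpq.symm, h]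
            rcases eq_or_ne r q with rfl | hrq
            · simp [h]
            · simp [Equiv.swap_apply_of_ne_of_ne hrp hrq, hrp, hrq]
          rw [hs, ξ.map_swap _ hpq, add_neg_cancel]
        · rintro j ⟨hjp, hjq⟩
          refine ξ.map_eq_zero_of_eq _ ?_ hpq
          rw [Function.update_of_ne hjp.symm, Function.update_of_ne hjq.symm, h] }
  map_add' ξ ξ' := by
    ext v
    simp [Finset.sum_add_distrib]
    abel
  map_smul' c ξ := by
    ext v
    simp [Finset.smul_sum, smul_sub]

section FormDeriv

variable (θ : Derivation 𝕂 R R) (ν : N →ₗ[𝕂] N)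
  (hν : ∀ (f : R) n, ν (f • n) = f • ν n + θ f • n)
  (δ : L →ₗ[𝕂] L) (hδ : ∀ (f : R) x, δ (f • x) = f • δ x + θ f • x)

theorem formDeriv_apply {n : ℕ} (ξ : L [⋀^Fin n]→ₗ[R] N) (v : Fin n → L) :
    formDeriv θ ν hν δ hδ n ξ v = ν (ξ v) - ∑ j, ξ (Function.update v j (δ (v j))) := rfl

theorem formDeriv_curryLeft {n : ℕ} (ξ : L [⋀^Fin (n + 1)]→ₗ[R] N) (x : L) :
    (formDeriv θ ν hν δ hδ (n + 1) ξ).curryLeft x =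
      formDeriv θ ν hν δ hδ n (ξ.curryLeft x) - ξ.curryLeft (δ x) := by
  ext v
  simp only [AlternatingMap.curryLeft_apply_apply, formDeriv_apply, AlternatingMap.sub_apply,
    Fin.sum_univ_succ, update_zero_vecCons, update_succ_vecCons, Matrix.cons_val_zero,
    Matrix.cons_val_succ]
  abel

variable (θ' : Derivation 𝕂 R R) (ν' : N →ₗ[𝕂] N)
  (hν' : ∀ (f : R) n, ν' (f • n) = f • ν' n + θ' f • n)
  (δ' : L →ₗ[𝕂] L) (hδ' : ∀ (f : R) x, δ' (f • x) = f • δ' x + θ' f • x)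
  (θ₁ : Derivation 𝕂 R R) (ν₁ : N →ₗ[𝕂] N)
  (hν₁ : ∀ (f : R) n, ν₁ (f • n) = f • ν₁ n + θ₁ f • n)
  (δ₁ : L →ₗ[𝕂] L) (hδ₁ : ∀ (f : R) x, δ₁ (f • x) = f • δ₁ x + θ₁ f • x)

/-- By `formDeriv_curryLeft`, contraction by `x` commutes with the derivation up to contraction by
`δ x`, so the claim drops one degree and no double sum over slots appears. It gives both flatness on
exterior powers and the commutator of Lie derivatives. -/
theorem formDeriv_commutator (hν_comm : ∀ n, ν₁ n = ν (ν' n) - ν' (ν n))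
    (hδ_comm : ∀ x, δ₁ x = δ (δ' x) - δ' (δ x)) {n : ℕ} (ξ : L [⋀^Fin n]→ₗ[R] N) :
    formDeriv θ₁ ν₁ hν₁ δ₁ hδ₁ n ξ =
      formDeriv θ ν hν δ hδ n (formDeriv θ' ν' hν' δ' hδ' n ξ) -
        formDeriv θ' ν' hν' δ' hδ' n (formDeriv θ ν hν δ hδ n ξ) := by
  induction n with
  | zero =>
    ext v
    simp [formDeriv_apply, hν_comm]
  | succ n ih =>
    refine AlternatingMap.ext_curryLeft fun x => ?_
    simp only [AlternatingMap.curryLeft_sub', formDeriv_curryLeft, ih, map_sub, hδ_comm]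
    abel

end FormDeriv

theorem Connection.exteriorDual_nabla {A : LieRinehartStr 𝕂 R L} (D : A.Connection P) (l : ℕ)
    (X : L) (β : P [⋀^Fin l]→ₗ[R] R) :
    (D.exteriorDual l).nabla X β =
      formDeriv (A.anchor X) (A.anchor X : R →ₗ[𝕂] R) (fun f g => by simp [mul_comm])
        (D.nabla X) (fun f p => D.nabla_smul_right f X p) l β := rfl

/-- The representation on `∧ˡ P*` induced by a representation on `P`. -/
def Representation.exteriorDual {A : LieRinehartStr 𝕂 R L} (D : A.Representation P) (l : ℕ) :
    A.Representation (P [⋀^Fin l]→ₗ[R] R) where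
  toConnection := D.toConnection.exteriorDual l
  flat X Y β := by
    simp only [Connection.exteriorDual_nabla]
    refine formDeriv_commutator _ _ _ _ _ _ _ _ _ _ _ _ _ _ _ (fun f => ?_) (fun p => ?_) β
    · rw [A.anchor_bracket]
      exact Derivation.commutator_apply (D1 := A.anchor X) (D2 := A.anchor Y) f
    · exact D.flat X Y p

/-- The Lie derivative of forms with values in `N`. -/
def lieDeriv {A : LieRinehartStr 𝕂 R L} (D : A.Connection N) (X : L) (n : ℕ) :
    (L [⋀^Fin n]→ₗ[R] N) →ₗ[𝕂] (L [⋀^Fin n]→ₗ[R] N) :=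
  formDeriv (A.anchor X) (D.nabla X) (fun f n => D.nabla_smul_right f X n) (A.bracket X)
    (fun f Y => A.leibniz X f Y) n

/-! ### Cartan's formula and `d² = 0`. -/

section Cartan

variable {A : LieRinehartStr 𝕂 R L}

theorem lieDeriv_apply (D : A.Connection N) (X : L) {n : ℕ} (ξ : L [⋀^Fin n]→ₗ[R] N)
    (v : Fin n → L) :
    lieDeriv D X n ξ v =
      D.nabla X (ξ v) - ∑ j, ξ (Function.update v j (A.bracket X (v j))) := rfl

theorem lieDeriv_curryLeft (D : A.Connection N) (X Y : L) {n : ℕ}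
    (ξ : L [⋀^Fin (n + 1)]→ₗ[R] N) :
    (lieDeriv D X (n + 1) ξ).curryLeft Y =
      lieDeriv D X n (ξ.curryLeft Y) - ξ.curryLeft (A.bracket X Y) :=
  formDeriv_curryLeft _ _ _ _ _ ξ Y

theorem lieDeriv_bracket (D : A.Representation N) (X Y : L) {n : ℕ} (ξ : L [⋀^Fin n]→ₗ[R] N) :
    lieDeriv D.toConnection (A.bracket X Y) n ξ =
      lieDeriv D.toConnection X n (lieDeriv D.toConnection Y n ξ) -
        lieDeriv D.toConnection Y n (lieDeriv D.toConnection X n ξ) :=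
  formDeriv_commutator _ _ _ _ _ _ _ _ _ _ _ _ _ _ _ (D.flat X Y)
    (fun Z => eq_sub_of_add_eq (A.jacobi X Y Z).symm) ξ

/-- The pairs containing the index of `X` give the slotwise action of `[X, ·]`. In every other pair,
moving `[X_i, X_j]` past `X` costs one sign, leaving the bracket term of the contracted form. This
is the combinatorial core of Cartan's formula. -/
theorem bracketTerm_vecCons {m : ℕ} (ξ : L [⋀^Fin (m + 1)]→ₗ[R] N) (X : L)
    (w : Fin (m + 1) → L) :
    A.bracketTerm ξ (Matrix.vecCons X w) =
      - (∑ j : Fin (m + 1), ξ (Function.update w j (A.bracket X (w j)))) -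
        A.bracketTerm (ξ.curryLeft X) w := by
  have hIci : Finset.Ici (0 : Fin (m + 1)) = Finset.univ := by ext; simp
  have h0 : ∑ j : Fin (m + 1), (-1 : ℤ) ^ ((0 : Fin (m + 1)) + j : ℕ) •
      ξ (Matrix.vecCons (A.bracket (Matrix.vecCons X w (Fin.castSucc 0))
          (Matrix.vecCons X w j.succ))
        (j.removeNth ((Fin.castSucc 0).removeNth (Matrix.vecCons X w : Fin (m + 2) → L)))) =
      ∑ j : Fin (m + 1), ξ (Function.update w j (A.bracket X (w j))) := by
    refine Finset.sum_congr rfl fun j _ => ?_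
    simp [AlternatingMap.map_update_eq_vecCons]
  rw [bracketTerm, Fin.sum_univ_succ, hIci, h0, neg_add, ← sub_eq_add_neg]
  congr 1
  cases m with
  | zero => simp [bracketTerm]
  | succ m =>
    rw [bracketTerm, ← Finset.sum_neg_distrib]
    refine Finset.sum_congr rfl fun i _ => ?_
    -- Removing `X` lowers both indices of the pair by one, so the exponent `i + j` changes by two
    -- and the only sign left is that of the swap `hsw`.
    rw [← Finset.sum_neg_distrib, ← Fin.map_succEmb_Ici, Finset.sum_map]
    refine Finset.sum_congr rfl fun j _ => ?_
    have hsw : ∀ (y : L) (u : Fin m → L), ξ (Matrix.vecCons y (Matrix.vecCons X u)) =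
        - ξ (Matrix.vecCons X (Matrix.vecCons y u)) := by
      intro y u
      have := ξ.map_swap (Matrix.vecCons X (Matrix.vecCons y u))
        (show (0 : Fin (m + 2)) ≠ 1 by simp)
      rw [← this]
      congr 1
      funext r
      refine Fin.cases ?_ (fun r => Fin.cases ?_ (fun r => ?_) r) r
      · simp
      · simp [Equiv.swap_apply_right]
      · rw [Function.comp_apply, Equiv.swap_apply_of_ne_of_ne (Fin.succ_ne_zero _)]
        · simp
        · simp [Fin.ext_iff]
    simp only [Fin.coe_succEmb, ← Fin.succ_castSucc, removeNth_succ_vecCons,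
      Matrix.cons_val_succ, hsw, AlternatingMap.curryLeft_apply_apply, Fin.val_succ]
    rw [smul_neg, ← neg_smul, ← neg_smul]
    congr 1
    ring

variable [CharZero 𝕂]

theorem differential_apply (D : A.Connection N) {n : ℕ} (ξ : L [⋀^Fin n]→ₗ[R] N)
    (v : Fin (n + 1) → L) :
    differential D n ξ v =
      ∑ i : Fin (n + 1), (-1 : ℤ) ^ (i : ℕ) • D.nabla (v i) (ξ (i.removeNth v)) +
        A.bracketTerm ξ v := rfl

theorem differential_curryLeft_zero (D : A.Connection N) (X : L) (ξ : L [⋀^Fin 0]→ₗ[R] N) :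
    (differential D 0 ξ).curryLeft X = lieDeriv D X 0 ξ := by
  ext v
  simp [differential_apply, bracketTerm, lieDeriv_apply]

/-- Cartan's formula `ι_X ∘ d + d ∘ ι_X = 𝓛_X`. -/
theorem differential_curryLeft (D : A.Connection N) (X : L) {n : ℕ}
    (ξ : L [⋀^Fin (n + 1)]→ₗ[R] N) :
    (differential D (n + 1) ξ).curryLeft X =
      lieDeriv D X (n + 1) ξ - differential D n (ξ.curryLeft X) := by
  ext w
  simp only [AlternatingMap.curryLeft_apply_apply, differential_apply, bracketTerm_vecCons,
    AlternatingMap.sub_apply, lieDeriv_apply]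
  rw [Fin.sum_univ_succ]
  simp only [removeNth_zero_vecCons, removeNth_succ_vecCons, Matrix.cons_val_zero,
    Matrix.cons_val_succ, Fin.val_zero, pow_zero, one_smul, Fin.val_succ, pow_succ, mul_neg,
    mul_one, neg_smul, Finset.sum_neg_distrib]
  abel

/-- Contraction with `Y` and Cartan's formula reduce the difference to `𝓛_{[X,Y]} = [𝓛_X, 𝓛_Y]` and
to the same statement for `ι_Y ξ`. Flatness enters through `lieDeriv_bracket`. -/
theorem lieDeriv_differential (D : A.Representation N) (X : L) {n : ℕ}
    (ξ : L [⋀^Fin n]→ₗ[R] N) :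
    lieDeriv D.toConnection X (n + 1) (differential D.toConnection n ξ) =
      differential D.toConnection n (lieDeriv D.toConnection X n ξ) := by
  induction n with
  | zero =>
    refine AlternatingMap.ext_curryLeft fun Y => ?_
    simp only [lieDeriv_curryLeft, differential_curryLeft_zero, lieDeriv_bracket]
    abel
  | succ n ih =>
    refine AlternatingMap.ext_curryLeft fun Y => ?_
    simp only [lieDeriv_curryLeft, differential_curryLeft, lieDeriv_bracket, map_sub, ih]
    abel

/-- `ι_Y d d = 𝓛_Y d - d ι_Y d = 𝓛_Y d - d 𝓛_Y + d d ι_Y = d d ι_Y`, which vanishes by induction; in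
degree zero the last term is absent. -/
theorem differential_differential (D : A.Representation N) {n : ℕ} (ξ : L [⋀^Fin n]→ₗ[R] N) :
    differential D.toConnection (n + 1) (differential D.toConnection n ξ) = 0 := by
  induction n with
  | zero =>
    refine AlternatingMap.ext_curryLeft fun Y => ?_
    rw [differential_curryLeft, lieDeriv_differential, differential_curryLeft_zero]
    simp
  | succ n ih =>
    refine AlternatingMap.ext_curryLeft fun Y => ?_
    rw [differential_curryLeft, lieDeriv_differential, differential_curryLeft, map_sub, ih]
    simp

end Cartan

end LieRinehartStr

/-! ## Restriction of forms on a bowtie sum -/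

namespace LieRinehartStr

variable {𝕂 R L P Q : Type*} [Field 𝕂] [CommRing R] [Algebra 𝕂 R]
  [AddCommGroup L] [Module R L] [Module 𝕂 L] [IsScalarTower 𝕂 R L]
  [AddCommGroup P] [Module R P] [Module 𝕂 P] [IsScalarTower 𝕂 R P]
  [AddCommGroup Q] [Module R Q] [Module 𝕂 Q] [IsScalarTower 𝕂 R Q]

/-- `i` and `j` embed `A` and `B` in `C` as complementary subalgebras whose mixed brackets are
given by the connections `DA` and `DB`. -/
structure IsBowtieEmbedding (A : LieRinehartStr 𝕂 R L) (B : LieRinehartStr 𝕂 R P)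
    (DA : A.Connection P) (DB : B.Connection L) (C : LieRinehartStr 𝕂 R Q)
    (i : L →ₗ[R] Q) (j : P →ₗ[R] Q) : Prop where
  bracket_inl : ∀ X X', C.bracket (i X) (i X') = i (A.bracket X X')
  bracket_inr : ∀ Y Y', C.bracket (j Y) (j Y') = j (B.bracket Y Y')
  bracket_inl_inr : ∀ X Y, C.bracket (i X) (j Y) = j (DA.nabla X Y) - i (DB.nabla Y X)
  anchor_inl : ∀ X, C.anchor (i X) = A.anchor X
  anchor_inr : ∀ Y, C.anchor (j Y) = B.anchor Y

theorem _root_.AlternatingMap.finset_sum_apply {ι κ N : Type*} [AddCommGroup N] [Module R N]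
    (s : Finset κ) (f : κ → L [⋀^ι]→ₗ[R] N) (v : ι → L) :
    (∑ a ∈ s, f a) v = ∑ a ∈ s, f a v :=
  map_sum (⟨⟨fun ξ => ξ v, rfl⟩, fun _ _ => rfl⟩ : (L [⋀^ι]→ₗ[R] N) →+ N) f s

theorem append_vecCons_comp_cast {k l n : ℕ} (h : k + 1 + l = n + 1) (h' : k + l = n) (q : Q)
    (u : Fin k → Q) (w : Fin l → Q) :
    Fin.append (Matrix.vecCons q u) w ∘ Fin.cast h.symm =
      Matrix.vecCons q (Fin.append u w ∘ Fin.cast h'.symm) := by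
  subst h'
  rw [Matrix.vecCons, Fin.append_cons]
  rfl

theorem comp_vecCons (i : L → Q) {k : ℕ} (X : L) (u : Fin k → L) :
    i ∘ (Matrix.vecCons X u : Fin (k + 1) → L) = Matrix.vecCons (i X) (i ∘ u) := by
  funext a
  refine Fin.cases ?_ (fun a => ?_) a <;> simp

theorem removeNth_append {k l n : ℕ} (h : k + (l + 1) = n + 1) (h' : k + l = n)
    (u : Fin k → Q) (w : Fin (l + 1) → Q) (a : Fin (l + 1)) :
    (Fin.cast h (Fin.natAdd k a)).removeNth (Fin.append u w ∘ Fin.cast h.symm) =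
      Fin.append u (a.removeNth w) ∘ Fin.cast h'.symm := by
  subst h'
  funext b
  refine Fin.addCases (fun b => ?_) (fun b => ?_) b
  · have : (Fin.cast h (Fin.natAdd k a)).succAbove (Fin.castAdd l b) =
        Fin.cast h (Fin.castAdd (l + 1) b) := by
      rw [Fin.succAbove_of_castSucc_lt _ _ (by rw [Fin.lt_def]; simp; omega)]
      rfl
    rw [Fin.removeNth_apply, Function.comp_apply, this]
    simp
  · have : (Fin.cast h (Fin.natAdd k a)).succAbove (Fin.natAdd k b) =
        Fin.cast h (Fin.natAdd k (a.succAbove b)) := by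
      rcases lt_or_ge b.castSucc a with hb | hb
      · rw [Fin.succAbove_of_castSucc_lt _ _ hb, Fin.succAbove_of_castSucc_lt _ _ (by
          rw [Fin.lt_def] at hb ⊢; simpa using hb)]
        rfl
      · rw [Fin.succAbove_of_le_castSucc _ _ hb, Fin.succAbove_of_le_castSucc _ _ (by
          rw [Fin.le_def] at hb ⊢; simpa using hb)]
        rfl
    rw [Fin.removeNth_apply, Function.comp_apply, this]
    simp [Fin.removeNth_apply]

section Restrict

variable (i : L →ₗ[R] Q) (j : P →ₗ[R] Q)

theorem restrictBiForm_apply {k l n : ℕ} (h : k + l = n) (ξ : Q [⋀^Fin n]→ₗ[R] R)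
    (X : Fin k → L) (Y : Fin l → P) :
    restrictBiForm (𝕂 := 𝕂) i j h ξ X Y = ξ (Fin.append (i ∘ X) (j ∘ Y) ∘ Fin.cast h.symm) := rfl

theorem restrictBiForm_curryLeft {k l n : ℕ} (h : k + 1 + l = n + 1) (h' : k + l = n)
    (ξ : Q [⋀^Fin (n + 1)]→ₗ[R] R) (X : L) :
    (restrictBiForm (𝕂 := 𝕂) i j h ξ).curryLeft X =
      restrictBiForm (𝕂 := 𝕂) i j h' (ξ.curryLeft (i X)) := by
  ext u w
  simp only [AlternatingMap.curryLeft_apply_apply, restrictBiForm_apply, comp_vecCons,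
    append_vecCons_comp_cast h h']

/-- Bringing a `B`-argument to the front moves it past `k` arguments from `A`; this is the source of
the sign `(-1)ᵏ` in the total differential. -/
theorem map_append_update_right {k l n : ℕ} (h : k + (l + 1) = n + 1) (h' : k + l = n)
    (ξ : Q [⋀^Fin (n + 1)]→ₗ[R] R) (u : Fin k → Q) (w : Fin (l + 1) → Q) (a : Fin (l + 1)) (q : Q) :
    ξ (Fin.append u (Function.update w a q) ∘ Fin.cast h.symm) =
      (-1 : ℤ) ^ (k + a : ℕ) •
        ξ (Matrix.vecCons q (Fin.append u (a.removeNth w) ∘ Fin.cast h'.symm)) := by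
  rw [append_update_right h, AlternatingMap.map_update_eq_vecCons, removeNth_append h h']
  simp

end Restrict

/-! ### Restriction intertwines `d` with the total differential. -/

section Chain

variable {A : LieRinehartStr 𝕂 R L} {B : LieRinehartStr 𝕂 R P} {DA : A.Connection P}
  {DB : B.Connection L} {C : LieRinehartStr 𝕂 R Q} {i : L →ₗ[R] Q} {j : P →ₗ[R] Q}

/-- The bracket `[iX, jY]` has two components. The component `j(∇_X Y)` belongs to the Lie
derivative along `X` with values in `∧ˡ B*`; the component `-i(∇_Y X)` moves a `B`-slot into `A` and
produces the correction sum. -/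
theorem restrictBiForm_lieDeriv (hC : IsBowtieEmbedding A B DA DB C i j) {k l n : ℕ}
    (h : k + l = n) (ξ : Q [⋀^Fin n]→ₗ[R] R) (X : L) (u : Fin k → L) (w : Fin l → P) :
    restrictBiForm (𝕂 := 𝕂) i j h (lieDeriv C.trivialRep.toConnection (i X) n ξ) u w =
      lieDeriv (DA.exteriorDual l) X k (restrictBiForm (𝕂 := 𝕂) i j h ξ) u w +
        ∑ b, ξ (Fin.append (i ∘ u) (Function.update (j ∘ w) b (i (DB.nabla (w b) X))) ∘
          Fin.cast h.symm) := by
  subst h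
  have hL : lieDeriv (DA.exteriorDual l) X k (restrictBiForm (𝕂 := 𝕂) i j rfl ξ) u w =
      A.anchor X (restrictBiForm (𝕂 := 𝕂) i j rfl ξ u w) -
        ∑ b, restrictBiForm (𝕂 := 𝕂) i j rfl ξ u (Function.update w b (DA.nabla X (w b))) -
        ∑ a, restrictBiForm (𝕂 := 𝕂) i j rfl ξ (Function.update u a (A.bracket X (u a))) w := by
    rw [lieDeriv_apply, AlternatingMap.sub_apply, AlternatingMap.finset_sum_apply]
    rfl
  have hQ : C.trivialRep.nabla (i X) = (A.anchor X : R →ₗ[𝕂] R) := by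
    rw [← hC.anchor_inl]; rfl
  rw [hL, restrictBiForm_apply, lieDeriv_apply, hQ, Fin.sum_univ_add]
  have ha : ∀ a : Fin k, ξ (Function.update (Fin.append (i ∘ u) (j ∘ w) ∘ Fin.cast rfl)
      (Fin.castAdd l a) (C.bracket (i X) ((Fin.append (i ∘ u) (j ∘ w) ∘ Fin.cast rfl)
        (Fin.castAdd l a)))) =
      restrictBiForm (𝕂 := 𝕂) i j rfl ξ (Function.update u a (A.bracket X (u a))) w := by
    intro a
    rw [restrictBiForm_apply, Function.comp_update, append_update_left rfl]
    simp [hC.bracket_inl]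
  have hb : ∀ b : Fin l, ξ (Function.update (Fin.append (i ∘ u) (j ∘ w) ∘ Fin.cast rfl)
      (Fin.natAdd k b) (C.bracket (i X) ((Fin.append (i ∘ u) (j ∘ w) ∘ Fin.cast rfl)
        (Fin.natAdd k b)))) =
      restrictBiForm (𝕂 := 𝕂) i j rfl ξ u (Function.update w b (DA.nabla X (w b))) -
      ξ (Fin.append (i ∘ u) (Function.update (j ∘ w) b (i (DB.nabla (w b) X))) ∘
          Fin.cast rfl) := by
    intro b
    rw [restrictBiForm_apply, Function.comp_update, append_update_right rfl,
      append_update_right rfl, eq_sub_iff_add_eq]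
    simp [hC.bracket_inl_inr, AlternatingMap.map_update_sub]
  simp only [ha, hb, Finset.sum_sub_distrib]
  simp only [restrictBiForm_apply, Derivation.coeFn_coe]
  abel

variable [CharZero 𝕂]

theorem partialA_curryLeft_zero {l : ℕ} (α : BiForm R L P 0 l) (X : L) :
    (partialA DA 0 l α).curryLeft X = lieDeriv (DA.exteriorDual l) X 0 α :=
  differential_curryLeft_zero _ X α

theorem partialA_curryLeft {k l : ℕ} (α : BiForm R L P (k + 1) l) (X : L) :
    (partialA DA (k + 1) l α).curryLeft X =
      lieDeriv (DA.exteriorDual l) X (k + 1) α - partialA DA k l (α.curryLeft X) :=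
  differential_curryLeft _ X α

/-- `∂_B` differentiates every `A`-argument, including the contracted `X`; the slot of `X` is the
whole defect. It has the same shape as the correction in `restrictBiForm_lieDeriv`. -/
theorem partialB_curryLeft {k l : ℕ} (α : BiForm R L P (k + 1) l) (X : L)
    (u : Fin k → L) (w : Fin (l + 1) → P) :
    (partialB DB (k + 1) l α).curryLeft X u w =
      partialB DB k l (α.curryLeft X) u w -
        ∑ b : Fin (l + 1), (-1 : ℤ) ^ (b : ℕ) •
          α (Matrix.vecCons (DB.nabla (w b) X) u) (b.removeNth w) := by
  rw [AlternatingMap.curryLeft_apply_apply, partialB_apply, partialB_apply]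
  have hb : B.bracketTerm (flipForm (𝕂 := 𝕂) α) w (Matrix.vecCons X u) =
      B.bracketTerm (flipForm (𝕂 := 𝕂) (α.curryLeft X)) w u := by
    cases l with
    | zero => rfl
    | succ l =>
      simp only [bracketTerm, AlternatingMap.neg_apply, AlternatingMap.finset_sum_apply,
        AlternatingMap.smul_apply]
      rfl
  rw [hb]
  simp only [Fin.sum_univ_succ (n := k), update_zero_vecCons, update_succ_vecCons,
    Matrix.cons_val_zero, Matrix.cons_val_succ, AlternatingMap.curryLeft_apply_apply,
    sub_add_eq_sub_sub, smul_sub, Finset.sum_sub_distrib]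
  abel

theorem restrictBiForm_differential_zero (hC : IsBowtieEmbedding A B DA DB C i j) {n : ℕ}
    (h : 0 + (n + 1) = n + 1) (ξ : Q [⋀^Fin n]→ₗ[R] R) :
    restrictBiForm (𝕂 := 𝕂) i j h (differential C.trivialRep.toConnection n ξ) =
      partialB DB 0 n (restrictBiForm (𝕂 := 𝕂) i j (zero_add n) ξ) := by
  have happ : ∀ {m : ℕ} (u : Fin 0 → Q) (w : Fin m → Q), Fin.append u w ∘
      Fin.cast (zero_add m).symm = w := by
    intro m u w
    rw [Fin.append_left_nil _ _ rfl]
    rfl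
  ext u w
  rw [partialB_apply, restrictBiForm_apply, differential_apply, happ]
  have hb : C.bracketTerm ξ (j ∘ w) =
      B.bracketTerm (flipForm (𝕂 := 𝕂) (restrictBiForm (𝕂 := 𝕂) i j (zero_add n) ξ)) w u := by
    cases n with
    | zero => rfl
    | succ n =>
      simp only [bracketTerm, AlternatingMap.neg_apply, AlternatingMap.finset_sum_apply,
        AlternatingMap.smul_apply]
      refine congrArg Neg.neg (Finset.sum_congr rfl fun a _ => Finset.sum_congr rfl fun b _ => ?_)
      congr 1
      change _ = ξ _
      rw [happ, comp_vecCons]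
      simp only [Function.comp_apply, hC.bracket_inr]
      rfl
  rw [hb]
  congr 1
  refine Finset.sum_congr rfl fun a _ => ?_
  congr 1
  simp only [Finset.univ_eq_empty, Finset.sum_empty, sub_zero, restrictBiForm_apply, happ]
  change C.anchor (j (w a)) _ = _
  rw [hC.anchor_inr]
  rfl

/-- Induction on the number of `A`-arguments, by contraction with `X`. Cartan's formula is applied
to `d` on the sum and to `∂_A`; what remains is the correction sum of the Lie derivative against the
defect of `∂_B`, and these agree. With no `A`-arguments only `∂_B` contributes. -/
theorem restrictBiForm_differential (hC : IsBowtieEmbedding A B DA DB C i j) (k l n : ℕ)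
    (h : k + l = n + 1) (ξ : Q [⋀^Fin n]→ₗ[R] R) :
    restrictBiForm (𝕂 := 𝕂) i j h (differential C.trivialRep.toConnection n ξ) =
      totalPartialA DA n ⟨(k, l), h⟩ (restrictTotal (𝕂 := 𝕂) i j n ξ) +
        totalPartialB DB n ⟨(k, l), h⟩ (restrictTotal (𝕂 := 𝕂) i j n ξ) := by
  induction k generalizing l n with
  | zero =>
    obtain rfl : l = n + 1 := by omega
    change _ = 0 + (-1 : ℤ) ^ 0 • partialB DB 0 n (restrictBiForm (𝕂 := 𝕂) i j (zero_add n) ξ)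
    rw [pow_zero, one_smul, zero_add, restrictBiForm_differential_zero hC]
  | succ k ih =>
    refine AlternatingMap.ext_curryLeft fun X => ?_
    rw [restrictBiForm_curryLeft (𝕂 := 𝕂) i j h (Nat.succ.inj ((Nat.succ_add k l).symm.trans h))]
    ext u w
    cases n with
    -- Here `ξ` is a function, so Cartan's formula has no `d ι_X` term.
    | zero =>
      obtain rfl : k = 0 := by omega
      obtain rfl : l = 0 := by omega
      rw [differential_curryLeft_zero, restrictBiForm_lieDeriv hC]
      change _ = (partialA DA 0 0 (restrictBiForm (𝕂 := 𝕂) i j (zero_add 0) ξ)).curryLeft X u w + 0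
      rw [partialA_curryLeft_zero]
      simp
    | succ n =>
      have h' : k + l = n + 1 := by omega
      rw [differential_curryLeft, map_sub, ih l n h', AlternatingMap.sub_apply,
        AlternatingMap.sub_apply, restrictBiForm_lieDeriv hC]
      have hA : (totalPartialA DA (n + 1) ⟨(k + 1, l), h⟩
          (restrictTotal (𝕂 := 𝕂) i j (n + 1) ξ)).curryLeft X =
          lieDeriv (DA.exteriorDual l) X k (restrictBiForm (𝕂 := 𝕂) i j h' ξ) -
            totalPartialA DA n ⟨(k, l), h'⟩ (restrictTotal (𝕂 := 𝕂) i j n (ξ.curryLeft (i X))) := by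
        cases k with
        | zero =>
          change (partialA DA 0 l (restrictBiForm (𝕂 := 𝕂) i j (by omega) ξ)).curryLeft X = _ - 0
          rw [partialA_curryLeft_zero]
          exact (sub_zero (_ : BiForm R L P 0 l)).symm
        | succ k =>
          change (partialA DA (k + 1) l (restrictBiForm (𝕂 := 𝕂) i j (by omega) ξ)).curryLeft X =
            _ - partialA DA k l (restrictBiForm (𝕂 := 𝕂) i j (by omega) _)
          rw [partialA_curryLeft, restrictBiForm_curryLeft]
      -- The prefactor is `(-1)^(k+1)` before contraction and `(-1)^k` after it. This turns `ι_X
      -- ∂_B` into minus the `∂_B` of the contraction and makes the defect equal to the correction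
      -- sum. For `l = 0` both are empty.
      have hB : (totalPartialB DB (n + 1) ⟨(k + 1, l), h⟩
          (restrictTotal (𝕂 := 𝕂) i j (n + 1) ξ)).curryLeft X u w =
          ∑ b, ξ (Fin.append (i ∘ u) (Function.update (j ∘ w) b (i (DB.nabla (w b) X))) ∘
            Fin.cast h'.symm) - totalPartialB DB n ⟨(k, l), h'⟩
              (restrictTotal (𝕂 := 𝕂) i j n (ξ.curryLeft (i X))) u w := by
        cases l with
        | zero =>
          change (0 : R) = _ - 0
          simp
        | succ l =>
          have h'' : k + l = n := by omega
          change ((-1 : ℤ) ^ (k + 1) • (partialB DB (k + 1) l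
            (restrictBiForm (𝕂 := 𝕂) i j (by omega) ξ)).curryLeft X u w) =
            _ - (-1 : ℤ) ^ k • partialB DB k l (restrictBiForm (𝕂 := 𝕂) i j (by omega) _) u w
          rw [partialB_curryLeft, restrictBiForm_curryLeft (h' := h'')]
          simp only [map_append_update_right h' h'', restrictBiForm_apply, comp_vecCons,
            append_vecCons_comp_cast (show k + 1 + l = n + 1 by omega) h'', pow_add, mul_smul,
            ← Finset.smul_sum]
          simp only [pow_one, neg_smul, one_smul, smul_sub, smul_neg]
          rw [sub_neg_eq_add, neg_add_eq_sub]
          rfl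
      have hsum : ((totalPartialA DA (n + 1) ⟨(k + 1, l), h⟩ (restrictTotal (𝕂 := 𝕂) i j (n + 1) ξ) +
          totalPartialB DB (n + 1) ⟨(k + 1, l), h⟩
            (restrictTotal (𝕂 := 𝕂) i j (n + 1) ξ)).curryLeft X u w) =
          (totalPartialA DA (n + 1) ⟨(k + 1, l), h⟩
            (restrictTotal (𝕂 := 𝕂) i j (n + 1) ξ)).curryLeft X u w +
          (totalPartialB DB (n + 1) ⟨(k + 1, l), h⟩
            (restrictTotal (𝕂 := 𝕂) i j (n + 1) ξ)).curryLeft X u w := rfl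
      rw [hsum, hA, hB]
      simp only [AlternatingMap.sub_apply, AlternatingMap.add_apply]
      abel

/-- Restriction of forms is a morphism of complexes. -/
theorem restrictTotal_differential (hC : IsBowtieEmbedding A B DA DB C i j) (n : ℕ) :
    totalDifferential DA DB n ∘ₗ restrictTotal i j n =
      restrictTotal i j (n + 1) ∘ₗ differential C.trivialRep.toConnection n := by
  refine LinearMap.ext fun ξ => funext fun ⟨⟨k, l⟩, h⟩ => ?_
  exact (restrictBiForm_differential hC k l n h ξ).symm

end Chain

end LieRinehartStr

/-! ## Restriction of forms on a direct sum is bijective -/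

namespace LieRinehartStr

variable {𝕂 R L P Q : Type*} [Field 𝕂] [CommRing R] [Algebra 𝕂 R]
  [AddCommGroup L] [Module R L] [Module 𝕂 L] [IsScalarTower 𝕂 R L]
  [AddCommGroup P] [Module R P] [Module 𝕂 P] [IsScalarTower 𝕂 R P]
  [AddCommGroup Q] [Module R Q] [Module 𝕂 Q] [IsScalarTower 𝕂 R Q]

/-- Every `q` is `iX + jY`, so by induction on the degree it suffices to contract with each kind of
vector. Contraction with `iX` commutes with restriction; contraction with `jY` does so up to a sign.
-/
theorem eq_zero_of_restrictBiForm_eq_zero {i : L →ₗ[R] Q} {j : P →ₗ[R] Q}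
    (hspan : ∀ q, ∃ X Y, q = i X + j Y) {n : ℕ} (ξ : Q [⋀^Fin n]→ₗ[R] R)
    (hξ : ∀ k l (h : k + l = n), restrictBiForm (𝕂 := 𝕂) i j h ξ = 0) : ξ = 0 := by
  induction n with
  | zero =>
    ext v
    have := congrArg (fun η => η ![] ![]) (hξ 0 0 rfl)
    simp only [restrictBiForm_apply] at this
    rw [Subsingleton.elim v]
    exact this
  | succ n ih =>
    refine AlternatingMap.ext_curryLeft fun q => ?_
    obtain ⟨X, Y, rfl⟩ := hspan q
    have hX : ξ.curryLeft (i X) = 0 := ih _ fun k l h => by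
      rw [← restrictBiForm_curryLeft i j (show k + 1 + l = n + 1 by omega) h, hξ]
      rfl
    have hY : ξ.curryLeft (j Y) = 0 := ih _ fun k l h => by
      ext u w
      have h' : k + (l + 1) = n + 1 := by omega
      have h1 := map_append_update_right h' h ξ (i ∘ u) (Matrix.vecCons 0 (j ∘ w)) 0 (j Y)
      have h2 : ξ (Fin.append (i ∘ u) (Function.update (Matrix.vecCons 0 (j ∘ w)) 0 (j Y)) ∘
          Fin.cast h'.symm) = 0 := by
        rw [update_zero_vecCons, ← comp_vecCons]
        exact congrArg (fun η => η u (Matrix.vecCons Y w)) (hξ k (l + 1) h')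
      rw [h2, removeNth_zero_vecCons] at h1
      rw [restrictBiForm_apply, AlternatingMap.curryLeft_apply_apply]
      rcases neg_one_pow_eq_or ℤ (k + (0 : Fin (l + 1)) : ℕ) with hs | hs
      · rw [hs, one_smul] at h1; exact h1.symm
      · rw [hs, neg_one_smul, zero_eq_neg] at h1; exact h1
    rw [map_add, hX, hY, add_zero]
    rfl

theorem restrictTotal_injective {i : L →ₗ[R] Q} {j : P →ₗ[R] Q}
    (hspan : ∀ q, ∃ X Y, q = i X + j Y) (n : ℕ) :
    Function.Injective (restrictTotal (𝕂 := 𝕂) i j n) := by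
  refine (injective_iff_map_eq_zero _).2 fun ξ hξ =>
    eq_zero_of_restrictBiForm_eq_zero (𝕂 := 𝕂) hspan ξ fun k l h => ?_
  exact congrFun hξ ⟨(k, l), h⟩

theorem comp_update_inl {ι κ V W : Type*} [DecidableEq ι] [DecidableEq κ] (g : V → W)
    (v : ι ⊕ κ → V) (a : ι) (z : V) :
    (fun c => g (Function.update v (Sum.inl a) z (Sum.inl c))) =
      Function.update (fun c => g (v (Sum.inl c))) a (g z) := by
  funext c
  by_cases hc : c = a
  · subst hc; simp
  · simp [hc]

theorem comp_update_inr {ι κ V W : Type*} [DecidableEq ι] [DecidableEq κ] (g : V → W)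
    (v : ι ⊕ κ → V) (b : κ) (z : V) :
    (fun c => g (Function.update v (Sum.inr b) z (Sum.inr c))) =
      Function.update (fun c => g (v (Sum.inr c))) b (g z) := by
  funext c
  by_cases hc : c = b
  · subst hc; simp
  · simp [hc]

/-- The multilinear form `v ↦ α (p v₁, …, p v_k, r v_{k+1}, …, r v_{k+l})`. -/
def BiForm.extend {k l : ℕ} (α : BiForm R L P k l) (p : Q →ₗ[R] L) (r : Q →ₗ[R] P) :
    MultilinearMap R (fun _ : Fin k ⊕ Fin l => Q) R where
  toFun v := α (fun a => p (v (Sum.inl a))) (fun b => r (v (Sum.inr b)))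
  map_update_add' := by
    intro inst v s x y
    obtain rfl : inst = instDecidableEqSum := Subsingleton.elim _ _
    rcases s with a | b
    · simp only [comp_update_inl, map_add, AlternatingMap.map_update_add, ne_eq, reduceCtorEq,
        not_false_eq_true, Function.update_of_ne, AlternatingMap.add_apply]
    · simp only [comp_update_inr, map_add, AlternatingMap.map_update_add, ne_eq, reduceCtorEq,
        not_false_eq_true, Function.update_of_ne]
  map_update_smul' := by
    intro inst v s f x
    obtain rfl : inst = instDecidableEqSum := Subsingleton.elim _ _
    rcases s with a | b
    · simp only [comp_update_inl, map_smul, AlternatingMap.map_update_smul, ne_eq, reduceCtorEq,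
        not_false_eq_true, Function.update_of_ne, AlternatingMap.smul_apply]
    · simp only [comp_update_inr, map_smul, AlternatingMap.map_update_smul, ne_eq, reduceCtorEq,
        not_false_eq_true, Function.update_of_ne]

theorem BiForm.extend_apply {k l : ℕ} (α : BiForm R L P k l) (p : Q →ₗ[R] L) (r : Q →ₗ[R] P)
    (v : Fin k ⊕ Fin l → Q) :
    α.extend p r v = α (fun a => p (v (Sum.inl a))) (fun b => r (v (Sum.inr b))) := rfl

/-! ### Surjectivity of restriction, by alternatization. -/

section Surjective

variable {i : L →ₗ[R] Q} {j : P →ₗ[R] Q} {p : Q →ₗ[R] L} {r : Q →ₗ[R] P}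

theorem BiForm.extend_eq_zero {k l : ℕ} (α : BiForm R L P k l) {v : Fin k ⊕ Fin l → Q}
    (hv : (∃ a, p (v (Sum.inl a)) = 0) ∨ ∃ b, r (v (Sum.inr b)) = 0) :
    α.extend p r v = 0 := by
  rw [BiForm.extend_apply]
  rcases hv with ⟨a, ha⟩ | ⟨b, hb⟩
  · rw [α.map_coord_zero a ha]; rfl
  · exact (α _).map_coord_zero b hb

/-- The permutations of `Fin k ⊕ Fin l` preserving the first summand. -/
def blockPerms (k l : ℕ) : Finset (Equiv.Perm (Fin k ⊕ Fin l)) :=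
  Finset.univ.filter fun σ => ∀ a, (σ (Sum.inl a)).isLeft

theorem one_mem_blockPerms (k l : ℕ) : (1 : Equiv.Perm (Fin k ⊕ Fin l)) ∈ blockPerms k l := by
  simp [blockPerms]

/-- A permutation mixing the blocks puts some `jY` into an `A`-slot, where `p` kills it. One
preserving them is a pair `(σ₁, σ₂)`, whose sign cancels the signs from the antisymmetry of `α`, so
each contributes `α X Y`. -/
theorem BiForm.alternatization_extend_apply (hpi : ∀ X, p (i X) = X) (hpj : ∀ Y, p (j Y) = 0)
    (hrj : ∀ Y, r (j Y) = Y) {k l : ℕ} (α : BiForm R L P k l) (X : Fin k → L) (Y : Fin l → P) :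
    MultilinearMap.alternatization (α.extend p r) (Sum.elim (i ∘ X) (j ∘ Y)) =
      (blockPerms k l).card • α X Y := by
  rw [MultilinearMap.alternatization_apply, ← Finset.sum_const]
  rw [blockPerms, Finset.sum_filter]
  refine Finset.sum_congr rfl fun σ _ => ?_
  rw [MultilinearMap.domDomCongr_apply]
  split_ifs with hσ
  · obtain ⟨⟨σ₁, σ₂⟩, rfl⟩ := Equiv.Perm.mem_sumCongrHom_range_of_perm_mapsTo_inl (σ := σ) (by
      rintro _ ⟨a, rfl⟩
      obtain ⟨b, hb⟩ := Sum.isLeft_iff.1 (hσ a)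
      exact ⟨b, hb.symm⟩)
    rw [BiForm.extend_apply]
    have h1 : (fun a => p (Sum.elim (i ∘ X) (j ∘ Y)
        (Equiv.Perm.sumCongrHom (Fin k) (Fin l) (σ₁, σ₂) (Sum.inl a)))) = X ∘ σ₁ := by
      funext a; simp [hpi]
    have h2 : (fun a => r (Sum.elim (i ∘ X) (j ∘ Y)
        (Equiv.Perm.sumCongrHom (Fin k) (Fin l) (σ₁, σ₂) (Sum.inr a)))) = Y ∘ σ₂ := by
      funext a; simp [hrj]
    rw [h1, h2, α.map_perm, AlternatingMap.smul_apply, (α X).map_perm, smul_smul, smul_smul,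
      Equiv.Perm.sumCongrHom_apply, Equiv.Perm.sign_sumCongr]
    rcases Int.units_eq_one_or (Equiv.Perm.sign σ₁) with h | h <;>
      rcases Int.units_eq_one_or (Equiv.Perm.sign σ₂) with h' | h' <;> simp [h, h']
  · push Not at hσ
    obtain ⟨a, ha⟩ := hσ
    rw [BiForm.extend_eq_zero α (Or.inl ⟨a, ?_⟩), smul_zero]
    obtain ⟨b, hb⟩ := Sum.isRight_iff.1 (by simpa using ha)
    simp [hb, hpj]

/-- A nonzero term would feed only `A`-vectors to the `k` slots and only `B`-vectors to the `l`
slots. Injectivity then gives `k ≤ k'` and `l ≤ l'`, and equal totals force `k = k'`. -/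
theorem BiForm.alternatization_extend_apply_of_ne (hpj : ∀ Y, p (j Y) = 0)
    (hri : ∀ X, r (i X) = 0) {k l k' l' n : ℕ} (h : k + l = n) (h' : k' + l' = n) (hne : k' ≠ k)
    (α : BiForm R L P k l) (X : Fin k' → L) (Y : Fin l' → P) :
    MultilinearMap.alternatization (α.extend p r) (fun s =>
      (Fin.append (i ∘ X) (j ∘ Y) ∘ Fin.cast h'.symm) (Fin.cast h (finSumFinEquiv s))) = 0 := by
  rw [MultilinearMap.alternatization_apply]
  refine Finset.sum_eq_zero fun σ _ => ?_
  rw [MultilinearMap.domDomCongr_apply, BiForm.extend_eq_zero, smul_zero]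
  by_contra! hcon
  obtain ⟨hl, hr⟩ := hcon
  -- `e s` is the position, among the `k'` vectors of `A` and `l'` of `B`, of the argument that `σ`
  -- sends to slot `s` of `α`.
  let e : Fin k ⊕ Fin l → Fin k' ⊕ Fin l' := fun s =>
    finSumFinEquiv.symm (Fin.cast h'.symm (Fin.cast h (finSumFinEquiv (σ s))))
  have he : Function.Injective e := fun s t hst => by simpa [e] using hst
  have hv : ∀ s, (Fin.append (i ∘ X) (j ∘ Y) ∘ Fin.cast h'.symm)
      (Fin.cast h (finSumFinEquiv (σ s))) = Sum.elim (i ∘ X) (j ∘ Y) (e s) := by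
    intro s
    obtain ⟨t, ht⟩ : ∃ t, t = e s := ⟨_, rfl⟩
    have : Fin.cast h'.symm (Fin.cast h (finSumFinEquiv (σ s))) = finSumFinEquiv t := by
      rw [ht]; simp [e]
    rw [Function.comp_apply, this, ← ht]
    rcases t with a | b <;> simp
  have h1 : ∀ a, ∃ a', e (Sum.inl a) = Sum.inl a' := by
    intro a
    rcases hs : e (Sum.inl a) with a' | b
    · exact ⟨a', rfl⟩
    · refine absurd ?_ (hl a)
      rw [hv, hs]
      simp [hpj]
  have h2 : ∀ b, ∃ b', e (Sum.inr b) = Sum.inr b' := by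
    intro b
    rcases hs : e (Sum.inr b) with a' | b'
    · refine absurd ?_ (hr b)
      rw [hv, hs]
      simp [hri]
    · exact ⟨b', rfl⟩
  choose f hf using h1
  choose g hg using h2
  have hf' : Function.Injective f := fun a b hab => by
    have : e (Sum.inl a) = e (Sum.inl b) := by rw [hf, hf, hab]
    simpa using he this
  have hg' : Function.Injective g := fun a b hab => by
    have : e (Sum.inr a) = e (Sum.inr b) := by rw [hg, hg, hab]
    simpa using he this
  have hk := Fintype.card_le_of_injective f hf'
  have hl := Fintype.card_le_of_injective g hg'
  simp only [Fintype.card_fin] at hk hl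
  omega

/-- The alternatization of `α` composed with the projections has no component other than `(k, l)`,
where it is `α` times the number of block permutations. That number is nonzero because the identity
is one of them, hence invertible in characteristic zero. -/
theorem exists_restrictTotal_eq_single [CharZero 𝕂] (hpi : ∀ X, p (i X) = X)
    (hpj : ∀ Y, p (j Y) = 0) (hri : ∀ X, r (i X) = 0) (hrj : ∀ Y, r (j Y) = Y) {n : ℕ}
    (s : {p : ℕ × ℕ // p.1 + p.2 = n}) (α : BiForm R L P s.1.1 s.1.2) :
    ∃ ξ, restrictTotal (𝕂 := 𝕂) i j n ξ = (Pi.single s α : TotalForm R L P n) := by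
  obtain ⟨⟨k, l⟩, h⟩ := s
  change BiForm R L P k l at α
  have hN : ((blockPerms k l).card : 𝕂) ≠ 0 := by
    rw [Nat.cast_ne_zero]
    exact Finset.card_ne_zero_of_mem (one_mem_blockPerms k l)
  refine ⟨((blockPerms k l).card : 𝕂)⁻¹ • (MultilinearMap.alternatization
    (α.extend p r)).domDomCongr (finSumFinEquiv.trans (finCongr h)), ?_⟩
  rw [map_smul]
  funext ⟨⟨k', l'⟩, h'⟩
  by_cases hk : k' = k
  · subst hk
    obtain rfl : l' = l := by omega
    rw [Pi.single_eq_same]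
    ext X Y
    change (_ : 𝕂) • MultilinearMap.alternatization (α.extend p r) (fun s =>
      (Fin.append (i ∘ X) (j ∘ Y) ∘ Fin.cast h'.symm) (Fin.cast h (finSumFinEquiv s))) = α X Y
    have : (fun s => (Fin.append (i ∘ X) (j ∘ Y) ∘ Fin.cast h'.symm)
        (Fin.cast h (finSumFinEquiv s))) = Sum.elim (i ∘ X) (j ∘ Y) := by
      funext s
      rcases s with a | b <;> simp
    rw [this, BiForm.alternatization_extend_apply hpi hpj hrj, ← Nat.cast_smul_eq_nsmul 𝕂,
      smul_smul, inv_mul_cancel₀ hN, one_smul]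
  · rw [Pi.single_eq_of_ne (by simpa using fun h _ => hk h)]
    ext X Y
    change (_ : 𝕂) • MultilinearMap.alternatization (α.extend p r) (fun s =>
      (Fin.append (i ∘ X) (j ∘ Y) ∘ Fin.cast h'.symm) (Fin.cast h (finSumFinEquiv s))) = 0
    rw [BiForm.alternatization_extend_apply_of_ne hpj hri h h' hk, smul_zero]

theorem restrictTotal_surjective [CharZero 𝕂] (hpi : ∀ X, p (i X) = X)
    (hpj : ∀ Y, p (j Y) = 0) (hri : ∀ X, r (i X) = 0) (hrj : ∀ Y, r (j Y) = Y) (n : ℕ) :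
    Function.Surjective (restrictTotal (𝕂 := 𝕂) i j n) := by
  intro α
  choose ξ hξ using fun s => exists_restrictTotal_eq_single (𝕂 := 𝕂) hpi hpj hri hrj s (α s)
  have : Fintype {p : ℕ × ℕ // p.1 + p.2 = n} :=
    Fintype.subtype (Finset.HasAntidiagonal.antidiagonal n) (by simp)
  refine ⟨∑ s, ξ s, ?_⟩
  rw [map_sum]
  simp only [hξ]
  exact Finset.univ_sum_single α

end Surjective

/-! ## The total complex and the double complex -/

section Total

variable {A : LieRinehartStr 𝕂 R L} {B : LieRinehartStr 𝕂 R P} {DA : A.Connection P}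
  {DB : B.Connection L} {C : LieRinehartStr 𝕂 R Q} {i : L →ₗ[R] Q} {j : P →ₗ[R] Q} [CharZero 𝕂]

/-- Every total cochain is the restriction of a form on the sum, and restriction carries `d² = 0` to
the total complex. -/
theorem totalDifferential_totalDifferential (hC : IsBowtieEmbedding A B DA DB C i j)
    (hsurj : ∀ n, Function.Surjective (restrictTotal (𝕂 := 𝕂) i j n)) (n : ℕ) :
    totalDifferential DA DB (n + 1) ∘ₗ totalDifferential DA DB n = 0 := by
  refine LinearMap.ext fun α => ?_
  obtain ⟨ξ, rfl⟩ := hsurj n α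
  have h1 := LinearMap.congr_fun (restrictTotal_differential hC n) ξ
  have h2 := LinearMap.congr_fun (restrictTotal_differential hC (n + 1))
    (differential C.trivialRep.toConnection n ξ)
  simp only [LinearMap.comp_apply] at h1 h2 ⊢
  rw [h1, h2, differential_differential, map_zero, LinearMap.zero_apply]

/-- On a cochain concentrated in bidegree `(k, l)`, the `(k+1, l+1)` component of `D²` is `(-1)ᵏ
(∂_A ∂_B - ∂_B ∂_A)`. -/
theorem partialB_partialA_of_totalDifferential
    (hd : ∀ n, totalDifferential (𝕂 := 𝕂) DA DB (n + 1) ∘ₗ totalDifferential DA DB n = 0) (k l : ℕ) :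
    partialB DB (k + 1) l ∘ₗ partialA DA k l = partialA DA k (l + 1) ∘ₗ partialB DB k l := by
  refine LinearMap.ext fun α => ?_
  let β : TotalForm R L P (k + l) := Pi.single ⟨(k, l), rfl⟩ α
  have hβ : β ⟨(k, l), rfl⟩ = α := Pi.single_eq_same _ _
  have hβ' : ∀ k' l' (h : k' + l' = k + l), k' ≠ k → β ⟨(k', l'), h⟩ = 0 := fun k' l' h hk =>
    Pi.single_eq_of_ne (by simpa using fun h _ => hk h) _
  have h0 := congrFun (LinearMap.congr_fun (hd (k + l)) β)
    ⟨(k + 1, l + 1), by simp only; omega⟩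
  have hA : totalDifferential DA DB (k + l) β ⟨(k, l + 1), by simp only; omega⟩ =
      (-1 : ℤ) ^ k • partialB DB k l α := by
    -- The other possible source of this component is bidegree `(k - 1, l + 1)`, where `β` vanishes.
    have h1 : totalPartialA DA (k + l) ⟨(k, l + 1), by simp only; omega⟩ β = 0 := by
      cases k with
      | zero => rfl
      | succ k =>
        change partialA DA k (l + 1) (β ⟨(k, l + 1), _⟩) = 0
        rw [hβ' _ _ _ (by omega), map_zero]
    change totalPartialA DA (k + l) _ β + _ = _
    rw [h1]
    change 0 + (-1 : ℤ) ^ k • partialB DB k l (β ⟨(k, l), rfl⟩) = _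
    rw [hβ, zero_add]
  have hB : totalDifferential DA DB (k + l) β ⟨(k + 1, l), by simp only; omega⟩ =
      partialA DA k l α := by
    have h1 : totalPartialB DB (k + l) ⟨(k + 1, l), by simp only; omega⟩ β = 0 := by
      cases l with
      | zero => rfl
      | succ l =>
        change (-1 : ℤ) ^ (k + 1) • partialB DB (k + 1) l (β ⟨(k + 1, l), _⟩) = 0
        rw [hβ' _ _ _ (by omega), map_zero, smul_zero]
    change _ + totalPartialB DB (k + l) _ β = _
    rw [h1]
    change partialA DA k l (β ⟨(k, l), rfl⟩) + 0 = _
    rw [hβ, add_zero]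
  change (partialA DA k (l + 1) (totalDifferential DA DB (k + l) β ⟨(k, l + 1), _⟩) :
      BiForm R L P (k + 1) (l + 1)) +
    (-1 : ℤ) ^ (k + 1) • partialB DB (k + 1) l
      (totalDifferential DA DB (k + l) β ⟨(k + 1, l), _⟩) = (0 : BiForm R L P (k + 1) (l + 1)) at h0
  rw [hA, hB, map_zsmul, pow_succ, mul_neg_one, neg_smul, ← sub_eq_add_neg, sub_eq_zero] at h0
  rcases neg_one_pow_eq_or ℤ k with hs | hs
  · rw [hs, one_smul, one_smul] at h0; exact h0.symm
  · rw [hs, neg_one_smul, neg_one_smul] at h0; exact neg_injective h0.symm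

end Total

end LieRinehartStr

/-- A bijective morphism of cochain complexes induces isomorphisms in cohomology. -/
theorem inducesCohomologyIso_of_bijective {𝕂 : Type*} [Field 𝕂] {C C' : ℕ → Type*}
    [∀ n, AddCommGroup (C n)] [∀ n, Module 𝕂 (C n)]
    [∀ n, AddCommGroup (C' n)] [∀ n, Module 𝕂 (C' n)]
    (d : ∀ n, C n →ₗ[𝕂] C (n + 1)) (d' : ∀ n, C' n →ₗ[𝕂] C' (n + 1))
    (f : ∀ n, C n →ₗ[𝕂] C' n) (hf : ∀ n, d' n ∘ₗ f n = f (n + 1) ∘ₗ d n)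
    (hb : ∀ n, Function.Bijective (f n)) : InducesCohomologyIso d d' f := by
  refine ⟨hf, fun n => ?_⟩
  have hf' : ∀ n x, d' n (f n x) = f (n + 1) (d n x) := fun n x => LinearMap.congr_fun (hf n) x
  have hker : ∀ x, f n x ∈ LinearMap.ker (d' n) ↔ x ∈ LinearMap.ker (d n) := by
    intro x
    rw [LinearMap.mem_ker, LinearMap.mem_ker, hf', map_eq_zero_iff _ (hb (n + 1)).1]
  have hcob : ∀ x, f n x ∈ coboundaries d' n ↔ x ∈ coboundaries d n := by
    intro x
    cases n with
    | zero => simp only [coboundaries, Submodule.mem_bot, map_eq_zero_iff _ (hb 0).1]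
    | succ n =>
      simp only [coboundaries, LinearMap.mem_range]
      constructor
      · rintro ⟨y, hy⟩
        obtain ⟨z, rfl⟩ := (hb n).2 y
        rw [hf'] at hy
        exact ⟨z, (hb (n + 1)).1 hy⟩
      · rintro ⟨z, rfl⟩
        exact ⟨f n z, hf' n z⟩
  let e : LinearMap.ker (d n) ≃ₗ[𝕂] LinearMap.ker (d' n) :=
    LinearEquiv.ofBijective ((f n).restrict fun x hx => (hker x).2 hx) (by
      constructor
      · intro x y hxy
        exact Subtype.ext ((hb n).1 (congrArg Subtype.val hxy))
      · rintro ⟨y, hy⟩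
        obtain ⟨x, rfl⟩ := (hb n).2 y
        exact ⟨⟨x, (hker x).1 hy⟩, rfl⟩)
  refine ⟨Submodule.Quotient.equiv _ _ e ?_, fun z => ⟨(hker z).2 z.2, rfl⟩⟩
  ext y
  obtain ⟨x, rfl⟩ := e.surjective y
  rw [Submodule.mem_map]
  constructor
  · rintro ⟨z, hz, hzx⟩
    obtain rfl := e.injective hzx
    exact (hcob _).2 hz
  · intro hx
    exact ⟨x, (hcob _).1 hx, rfl⟩

/-! ## Matched pairs -/

namespace LieRinehartStr

variable {𝕂 R L P : Type*} [Field 𝕂] [CommRing R] [Algebra 𝕂 R]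
  [AddCommGroup L] [Module R L] [Module 𝕂 L] [IsScalarTower 𝕂 R L]
  [AddCommGroup P] [Module R P] [Module 𝕂 P] [IsScalarTower 𝕂 R P]
  {A : LieRinehartStr 𝕂 R L} {B : LieRinehartStr 𝕂 R P}
  {DA : A.Representation P} {DB : B.Representation L}

theorem IsMatchedPair.symm (h : IsMatchedPair A B DA DB) : IsMatchedPair B A DB DA where
  anchor_lie Y X := by
    rw [← lie_skew, h.anchor_lie]
    abel
  nabla_bracket_right := h.nabla_bracket_left
  nabla_bracket_left := h.nabla_bracket_right

/-- This is the `A`-component of the Jacobi identity. Terms with three `X`s are the Jacobi identity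
of `A`, those with two `Y`s are flatness of the `B`-connection, and those with one `Y` are
`nabla_bracket_left`. The `B`-component follows by exchanging the roles of `A` and `B`. -/
theorem IsMatchedPair.jacobi_left (h : IsMatchedPair A B DA DB) (X₁ X₂ X₃ : L) (Y₁ Y₂ Y₃ : P) :
    A.bracket X₁ (A.bracket X₂ X₃ + DB.nabla Y₂ X₃ - DB.nabla Y₃ X₂) +
        DB.nabla Y₁ (A.bracket X₂ X₃ + DB.nabla Y₂ X₃ - DB.nabla Y₃ X₂) -
        DB.nabla (B.bracket Y₂ Y₃ + DA.nabla X₂ Y₃ - DA.nabla X₃ Y₂) X₁ =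
      (A.bracket (A.bracket X₁ X₂ + DB.nabla Y₁ X₂ - DB.nabla Y₂ X₁) X₃ +
        DB.nabla (B.bracket Y₁ Y₂ + DA.nabla X₁ Y₂ - DA.nabla X₂ Y₁) X₃ -
        DB.nabla Y₃ (A.bracket X₁ X₂ + DB.nabla Y₁ X₂ - DB.nabla Y₂ X₁)) +
      (A.bracket X₂ (A.bracket X₁ X₃ + DB.nabla Y₁ X₃ - DB.nabla Y₃ X₁) +
        DB.nabla Y₂ (A.bracket X₁ X₃ + DB.nabla Y₁ X₃ - DB.nabla Y₃ X₁) -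
        DB.nabla (B.bracket Y₁ Y₃ + DA.nabla X₁ Y₃ - DA.nabla X₃ Y₁) X₂) := by
  simp only [map_add, map_sub, LinearMap.add_apply, LinearMap.sub_apply, A.jacobi X₁ X₂ X₃,
    DB.flat, h.nabla_bracket_left, A.bracket_anti (DB.nabla Y₃ X₁) X₂]
  abel

/-- The Lie–Rinehart algebra `A ⋈ B` on `L × P` of a matched pair. -/
def IsMatchedPair.bowtie (h : IsMatchedPair A B DA DB) : LieRinehartStr 𝕂 R (L × P) where
  bracket := LinearMap.mk₂ 𝕂
    (fun u v => (A.bracket u.1 v.1 + DB.nabla u.2 v.1 - DB.nabla v.2 u.1,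
      B.bracket u.2 v.2 + DA.nabla u.1 v.2 - DA.nabla v.1 u.2))
    (fun u u' v => by ext <;> simp <;> abel)
    (fun c u v => by ext <;> simp [smul_sub])
    (fun u v v' => by ext <;> simp <;> abel)
    (fun c u v => by ext <;> simp [smul_sub])
  anchor := A.anchor.coprod B.anchor
  bracket_self u := by ext <;> simp [A.bracket_self, B.bracket_self]
  jacobi u v w := Prod.ext (h.jacobi_left u.1 v.1 w.1 u.2 v.2 w.2)
    (h.symm.jacobi_left u.2 v.2 w.2 u.1 v.1 w.1)
  anchor_bracket u v := by
    have h1 := h.anchor_lie u.1 v.2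
    have h2 := h.anchor_lie v.1 u.2
    rw [← lie_skew, neg_eq_iff_eq_neg] at h2
    simp only [LinearMap.mk₂_apply, LinearMap.coprod_apply, map_add, map_sub, A.anchor_bracket,
      B.anchor_bracket, add_lie, lie_add, h1, h2]
    abel
  leibniz u f v := by
    ext
    · simp only [LinearMap.mk₂_apply, Prod.smul_fst, Prod.smul_snd, A.leibniz, DB.nabla_smul_left,
        DB.nabla_smul_right, Prod.fst_add, LinearMap.coprod_apply, Derivation.add_apply, add_smul,
        smul_sub, smul_add]
      abel
    · simp only [LinearMap.mk₂_apply, Prod.smul_fst, Prod.smul_snd, B.leibniz, DA.nabla_smul_left,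
        DA.nabla_smul_right, Prod.snd_add, LinearMap.coprod_apply, Derivation.add_apply, add_smul,
        smul_sub, smul_add]
      abel

/-! ### Commuting differentials -/

section Commute

variable [CharZero 𝕂]

/-- Functions, as `(0,0)`-cochains, and dual elements, as `(0,1)`-cochains, are the only test forms
needed for the converse. -/
theorem partialA_const (DA : A.Connection P) (f : R) (u : Fin 1 → L) (w : Fin 0 → P) :
    partialA DA 0 0 (AlternatingMap.constOfIsEmpty R L (Fin 0)
      (AlternatingMap.constOfIsEmpty R P (Fin 0) f)) u w = A.anchor (u 0) f := by
  rw [partialA_apply]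
  simp [bracketTerm]

theorem partialB_const (DB : B.Connection L) (f : R) (u : Fin 0 → L) (w : Fin 1 → P) :
    partialB DB 0 0 (AlternatingMap.constOfIsEmpty R L (Fin 0)
      (AlternatingMap.constOfIsEmpty R P (Fin 0) f)) u w = B.anchor (w 0) f := by
  rw [partialB_apply]
  simp [bracketTerm]

theorem partialA_dual (DA : A.Connection P) (φ : P →ₗ[R] R) (u : Fin 1 → L) (w : Fin 1 → P) :
    partialA DA 0 1 (AlternatingMap.constOfIsEmpty R L (Fin 0)
      (AlternatingMap.ofSubsingleton R P R (0 : Fin 1) φ)) u w =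
      A.anchor (u 0) (φ (w 0)) - φ (DA.nabla (u 0) (w 0)) := by
  rw [partialA_apply]
  simp [bracketTerm]

theorem partialB_dual (DB : B.Connection L) (φ : P →ₗ[R] R) (u : Fin 0 → L) (w : Fin 2 → P) :
    partialB DB 0 1 (AlternatingMap.constOfIsEmpty R L (Fin 0)
      (AlternatingMap.ofSubsingleton R P R (0 : Fin 1) φ)) u w =
      B.anchor (w 0) (φ (w 1)) - B.anchor (w 1) (φ (w 0)) - φ (B.bracket (w 0) (w 1)) := by
  rw [partialB_apply]
  simp [bracketTerm, Fin.sum_univ_two, flipForm, Fin.removeNth_apply]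
  abel

/-- On a function `f`, `∂_B ∂_A f` gives `b(Y)a(X)f - a(∇_Y X)f` and `∂_A ∂_B f` gives `a(X)b(Y)f -
b(∇_X Y)f`. -/
theorem anchor_lie_of_commute
    (h : partialB DB.toConnection 1 0 ∘ₗ partialA DA.toConnection 0 0 =
      partialA DA.toConnection 0 1 ∘ₗ partialB DB.toConnection 0 0) (X : L) (Y : P) :
    ⁅A.anchor X, B.anchor Y⁆ = - A.anchor (DB.nabla Y X) + B.anchor (DA.nabla X Y) := by
  ext f
  have := congrArg (fun β => β ![X] ![Y]) (LinearMap.congr_fun h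
    (AlternatingMap.constOfIsEmpty R L (Fin 0) (AlternatingMap.constOfIsEmpty R P (Fin 0) f)))
  simp only [LinearMap.comp_apply] at this
  rw [partialB_apply, partialA_apply] at this
  simp [bracketTerm, partialA_const, partialB_const] at this
  rw [Derivation.commutator_apply, Derivation.add_apply, Derivation.neg_apply]
  linear_combination -this

/-- Commutation is tested on `φ` and evaluated at `(X; Y₁, Y₂)`. Once the derivatives of `φ(Y₁)` and
`φ(Y₂)` are accounted for, `φ` of the defect of the identity remains, and `hsep` removes `φ`. -/
theorem nabla_bracket_of_commute
    (h0 : partialB DB.toConnection 1 0 ∘ₗ partialA DA.toConnection 0 0 =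
      partialA DA.toConnection 0 1 ∘ₗ partialB DB.toConnection 0 0)
    (h1 : partialB DB.toConnection 1 1 ∘ₗ partialA DA.toConnection 0 1 =
      partialA DA.toConnection 0 2 ∘ₗ partialB DB.toConnection 0 1)
    (hsep : ∀ Y : P, (∀ φ : P →ₗ[R] R, φ Y = 0) → Y = 0) (X : L) (Y₁ Y₂ : P) :
    DA.nabla X (B.bracket Y₁ Y₂) =
      B.bracket (DA.nabla X Y₁) Y₂ + B.bracket Y₁ (DA.nabla X Y₂) +
        DA.nabla (DB.nabla Y₂ X) Y₁ - DA.nabla (DB.nabla Y₁ X) Y₂ := by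
  rw [← sub_eq_zero]
  refine hsep _ fun φ => ?_
  have := congrArg (fun β => β ![X] ![Y₁, Y₂]) (LinearMap.congr_fun h1
    (AlternatingMap.constOfIsEmpty R L (Fin 0)
      (AlternatingMap.ofSubsingleton R P R (0 : Fin 1) φ)))
  simp only [LinearMap.comp_apply] at this
  have hX : ∀ Y f, A.anchor X (B.anchor Y f) - B.anchor Y (A.anchor X f) =
      - A.anchor (DB.nabla Y X) f + B.anchor (DA.nabla X Y) f := fun Y f => by
    have := congrArg (fun D => D f) (anchor_lie_of_commute h0 X Y)
    exact this
  rw [partialB_apply, partialA_apply] at this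
  simp [bracketTerm, partialA_dual, partialB_dual, Fin.sum_univ_two, flipForm,
    Fin.removeNth_apply] at this
  -- The second derivatives of `φ Y₁` and `φ Y₂` occur only as commutators of anchors, which the
  -- anchor identity turns into first-order terms.
  have e1 := hX Y₁ (φ Y₂)
  have e2 := hX Y₂ (φ Y₁)
  simp only [map_sub, map_add]
  linear_combination this + e1 - e2

/-- Exchanging the two groups of arguments is an involution that swaps `∂_A` and `∂_B`, so the
second bracket identity is the first with the roles of `A` and `B` reversed. -/
theorem commute_flip {k l : ℕ}
    (h : partialB DB.toConnection (k + 1) l ∘ₗ partialA DA.toConnection k l =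
      partialA DA.toConnection k (l + 1) ∘ₗ partialB DB.toConnection k l) :
    partialB DA.toConnection (l + 1) k ∘ₗ partialA DB.toConnection l k =
      partialA DB.toConnection l (k + 1) ∘ₗ partialB DA.toConnection l k := by
  refine LinearMap.ext fun α => ?_
  exact congrArg (flipForm (𝕂 := 𝕂)) (LinearMap.congr_fun h (flipForm (𝕂 := 𝕂) α)).symm

theorem isMatchedPair_of_commute
    (h : ∀ k l, partialB DB.toConnection (k + 1) l ∘ₗ partialA DA.toConnection k l =
      partialA DA.toConnection k (l + 1) ∘ₗ partialB DB.toConnection k l)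
    (hL : ∀ X : L, (∀ φ : L →ₗ[R] R, φ X = 0) → X = 0)
    (hP : ∀ Y : P, (∀ φ : P →ₗ[R] R, φ Y = 0) → Y = 0) : IsMatchedPair A B DA DB where
  anchor_lie := anchor_lie_of_commute (h 0 0)
  nabla_bracket_right := nabla_bracket_of_commute (h 0 0) (h 0 1) hP
  nabla_bracket_left := nabla_bracket_of_commute (commute_flip (h 0 0)) (commute_flip (h 1 0)) hL

end Commute

end LieRinehartStr

/-! ## Smooth sections -/

/-! ### Duals separate smooth sections. -/

section Separation

variable {𝕂 : Type*} [RCLike 𝕂] {E : Type*} [NormedAddCommGroup E] [NormedSpace ℝ E]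
  {M : Type*} [TopologicalSpace M] [ChartedSpace E M]
  {F : Type*} [NormedAddCommGroup F] [NormedSpace ℝ F] [NormedSpace 𝕂 F]
  [IsScalarTower ℝ 𝕂 F]
  {V : M → Type*} [TopologicalSpace (TotalSpace F V)] [∀ x, TopologicalSpace (V x)]
  [∀ x, AddCommGroup (V x)] [∀ x, Module ℝ (V x)] [∀ x, Module 𝕂 (V x)]
  [FiberBundle F V] [VectorBundle ℝ F V] [VectorBundle 𝕂 F V]

theorem contMDiff_localDual [ContMDiffVectorBundle ∞ F V 𝓘(ℝ, E)] (x₀ : M) (ψ : M → ℝ)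
    (hψ : ContMDiff 𝓘(ℝ, E) 𝓘(ℝ, ℝ) ∞ ψ)
    (hs : tsupport ψ ⊆ (trivializationAt F V x₀).baseSet) (φ : F →L[𝕂] 𝕂)
    (s : Cₛ^∞⟮𝓘(ℝ, E); F, V⟯) :
    ContMDiff 𝓘(ℝ, E) 𝓘(ℝ, 𝕂) ∞ fun x => ψ x • φ ((trivializationAt F V x₀ ⟨x, s x⟩).2) := by
  refine contMDiff_of_tsupport fun x hx => ?_
  have hx' : x ∈ (trivializationAt F V x₀).baseSet := hs (tsupport_smul_subset_left _ _ hx)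
  have h1 := ((trivializationAt F V x₀).contMDiffAt_section_iff (n := ∞) (IB := 𝓘(ℝ, E))
    (s := s) hx').1 (s.contMDiff x)
  have h2 := ((φ.restrictScalars ℝ).contMDiff (n := ∞)).contMDiffAt.comp x h1
  exact (hψ x).smul h2

/-- If `s x₀ ≠ 0`, a functional on the model fibre that is nonzero on the trivialized value, cut off
by a bump function supported in the trivializing set, is a globally defined dual not vanishing on
`s`. -/
theorem exists_dual_ne_zero [FiniteDimensional ℝ E] [IsManifold 𝓘(ℝ, E) ∞ M] [T2Space M]
    [ContMDiffVectorBundle ∞ F V 𝓘(ℝ, E)] (s : Cₛ^∞⟮𝓘(ℝ, E); F, V⟯)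
    (hs : ∀ φ : Cₛ^∞⟮𝓘(ℝ, E); F, V⟯ →ₗ[SmoothFn 𝕂 E M] SmoothFn 𝕂 E M, φ s = 0) : s = 0 := by
  ext x₀
  by_contra hne
  set e := trivializationAt F V x₀
  have hx₀ : x₀ ∈ e.baseSet := mem_baseSet_trivializationAt F V x₀
  have hv : (e ⟨x₀, s x₀⟩).2 ≠ 0 := by
    intro h0
    apply hne
    have h1 := e.symmₗ_linearMapAt (R := 𝕂) hx₀ (s x₀)
    rw [e.coe_linearMapAt_of_mem hx₀] at h1
    simp only [h0, map_zero] at h1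
    exact h1.symm
  obtain ⟨φ, -, hφ⟩ := exists_dual_vector 𝕂 _ (norm_ne_zero_iff.2 hv)
  obtain ⟨ψ, -, hψ⟩ := ((SmoothBumpFunction.nhds_basis_tsupport (I := 𝓘(ℝ, E)) x₀).mem_iff).1
    (e.open_baseSet.mem_nhds hx₀)
  -- Off `e.baseSet` the trivialization need not be linear; linearity of `Φ` holds there only
  -- because `ψ` vanishes.
  have hψ0 : ∀ x ∉ e.baseSet, ψ x = 0 := fun x hx =>
    image_eq_zero_of_notMem_tsupport fun h => hx (hψ h)
  let Φ : Cₛ^∞⟮𝓘(ℝ, E); F, V⟯ →ₗ[SmoothFn 𝕂 E M] SmoothFn 𝕂 E M :=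
    { toFun := fun t => ⟨_, contMDiff_localDual x₀ ψ ψ.contMDiff hψ φ t⟩
      map_add' := fun t t' => by
        ext x
        change ψ x • φ (e ⟨x, t x + t' x⟩).2 = ψ x • φ (e ⟨x, t x⟩).2 + ψ x • φ (e ⟨x, t' x⟩).2
        by_cases hx : x ∈ e.baseSet
        · rw [(e.linear 𝕂 hx).1, map_add, smul_add]
        · simp [hψ0 x hx]
      map_smul' := fun f t => by
        ext x
        change ψ x • φ (e ⟨x, f x • t x⟩).2 = f x * ψ x • φ (e ⟨x, t x⟩).2
        by_cases hx : x ∈ e.baseSet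
        · rw [(e.linear 𝕂 hx).2, map_smul, smul_eq_mul, mul_smul_comm]
        · simp [hψ0 x hx] }
  have h0 : Φ s x₀ = 0 := by rw [hs]; rfl
  change ψ x₀ • φ _ = 0 at h0
  rw [ψ.eq_one, one_smul, hφ] at h0
  simp at h0
  exact hv h0

end Separation

/-! ### Sections of `A ⊕ B` and the Lie algebroid `A ⋈ B`. -/

section SectionSum

variable {𝕂 : Type*} [RCLike 𝕂] {E : Type*} [NormedAddCommGroup E] [NormedSpace ℝ E]
  {M : Type*} [TopologicalSpace M] [ChartedSpace E M]
  {F₁ : Type*} [NormedAddCommGroup F₁] [NormedSpace ℝ F₁] [NormedSpace 𝕂 F₁]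
  [IsScalarTower ℝ 𝕂 F₁]
  {A : M → Type*} [TopologicalSpace (TotalSpace F₁ A)] [∀ x, TopologicalSpace (A x)]
  [∀ x, AddCommGroup (A x)] [∀ x, Module ℝ (A x)] [∀ x, Module 𝕂 (A x)]
  [FiberBundle F₁ A] [VectorBundle ℝ F₁ A] [VectorBundle 𝕂 F₁ A]
  {F₂ : Type*} [NormedAddCommGroup F₂] [NormedSpace ℝ F₂] [NormedSpace 𝕂 F₂]
  [IsScalarTower ℝ 𝕂 F₂]
  {B : M → Type*} [TopologicalSpace (TotalSpace F₂ B)] [∀ x, TopologicalSpace (B x)]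
  [∀ x, AddCommGroup (B x)] [∀ x, Module ℝ (B x)] [∀ x, Module 𝕂 (B x)]
  [FiberBundle F₂ B] [VectorBundle ℝ F₂ B] [VectorBundle 𝕂 F₂ B]

variable (𝕂 E F₁ A F₂ B) in
/-- Sections of `A ⊕ B` are pairs of sections of `A` and `B`. -/
noncomputable def sectionSumEquiv : Cₛ^∞⟮𝓘(ℝ, E); F₁ × F₂, A ×ᵇ B⟯ ≃ₗ[SmoothFn 𝕂 E M]
    (Cₛ^∞⟮𝓘(ℝ, E); F₁, A⟯ × Cₛ^∞⟮𝓘(ℝ, E); F₂, B⟯) where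
  toFun Z :=
    (⟨fun x => (Z x).1, fun x₀ => by
      have h := Z.contMDiff x₀
      rw [contMDiffAt_section] at h ⊢
      exact (contDiff_fst (𝕜 := ℝ) (E := F₁) (F := F₂)).contMDiff.contMDiffAt.comp x₀ h⟩,
    ⟨fun x => (Z x).2, fun x₀ => by
      have h := Z.contMDiff x₀
      rw [contMDiffAt_section] at h ⊢
      exact (contDiff_snd (𝕜 := ℝ) (E := F₁) (F := F₂)).contMDiff.contMDiffAt.comp x₀ h⟩)
  invFun u := sectionSum u.1 u.2
  map_add' _ _ := rfl
  map_smul' _ _ := rfl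
  left_inv _ := rfl
  right_inv _ := rfl

theorem sectionSumEquiv_sectionSum (X : Cₛ^∞⟮𝓘(ℝ, E); F₁, A⟯) (Y : Cₛ^∞⟮𝓘(ℝ, E); F₂, B⟯) :
    sectionSumEquiv 𝕂 E F₁ A F₂ B (sectionSum X Y) = (X, Y) := rfl

variable {LA : LieAlgebroid 𝕂 E F₁ A} {LB : LieAlgebroid 𝕂 E F₂ B}
  {DA : LA.toStr.Representation Cₛ^∞⟮𝓘(ℝ, E); F₂, B⟯}
  {DB : LB.toStr.Representation Cₛ^∞⟮𝓘(ℝ, E); F₁, A⟯}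

/-- Links the pointwise bundle map `a + b` to the algebraic anchor on pairs of sections; smoothness
of the anchor, the Leibniz rule and anchor compatibility then transfer from `IsMatchedPair.bowtie`.
-/
theorem bowtie_anchor_apply (h : IsMatchedPair LA.toStr LB.toStr DA DB)
    (Z : Cₛ^∞⟮𝓘(ℝ, E); F₁ × F₂, A ×ᵇ B⟯) (f : SmoothFn 𝕂 E M) (x : M) :
    tangentDeriv f x ((LA.anchor x).coprod (LB.anchor x) (Z x)) =
      h.bowtie.anchor (sectionSumEquiv 𝕂 E F₁ A F₂ B Z) f x := by
  rw [LinearMap.coprod_apply, map_add]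
  rfl

/-- The Lie algebroid `A ⋈ B` of a matched pair. -/
noncomputable def bowtieLieAlgebroid (h : IsMatchedPair LA.toStr LB.toStr DA DB) :
    LieAlgebroid 𝕂 E (F₁ × F₂) (A ×ᵇ B) where
  anchor x := (LA.anchor x).coprod (LB.anchor x)
  contMDiff_anchor Z f := by
    refine (h.bowtie.anchor (sectionSumEquiv 𝕂 E F₁ A F₂ B Z) f).contMDiff.congr fun x => ?_
    exact bowtie_anchor_apply h Z f x
  bracket := (h.bowtie.bracket.compl₁₂
    ((sectionSumEquiv 𝕂 E F₁ A F₂ B).toLinearMap.restrictScalars 𝕂)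
    ((sectionSumEquiv 𝕂 E F₁ A F₂ B).toLinearMap.restrictScalars 𝕂)).compr₂
      ((sectionSumEquiv 𝕂 E F₁ A F₂ B).symm.toLinearMap.restrictScalars 𝕂)
  bracket_self Z := congrArg (sectionSumEquiv 𝕂 E F₁ A F₂ B).symm (h.bowtie.bracket_self _)
  jacobi Z W T := congrArg (sectionSumEquiv 𝕂 E F₁ A F₂ B).symm (h.bowtie.jacobi _ _ _)
  leibniz Z W f := by
    refine (congrArg (sectionSumEquiv 𝕂 E F₁ A F₂ B).symm
      (h.bowtie.leibniz (sectionSumEquiv 𝕂 E F₁ A F₂ B Z) f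
        (sectionSumEquiv 𝕂 E F₁ A F₂ B W))).trans ?_
    rw [map_add, map_smul, map_smul, LinearEquiv.symm_apply_apply]
    congr 2
    ext x
    exact (bowtie_anchor_apply h Z f x).symm
  anchor_bracket Z W f x := by
    have h1 := congrArg (fun D => D f x) (h.bowtie.anchor_bracket
      (sectionSumEquiv 𝕂 E F₁ A F₂ B Z) (sectionSumEquiv 𝕂 E F₁ A F₂ B W))
    have h2 : ∀ T : Cₛ^∞⟮𝓘(ℝ, E); F₁ × F₂, A ×ᵇ B⟯, ∀ hT, SmoothFn.of (fun y =>
        tangentDeriv f y ((LA.anchor y).coprod (LB.anchor y) (T y))) hT =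
        h.bowtie.anchor (sectionSumEquiv 𝕂 E F₁ A F₂ B T) f := fun T hT => by
      ext y
      exact bowtie_anchor_apply h T f y
    rw [h2, h2, bowtie_anchor_apply, bowtie_anchor_apply h, bowtie_anchor_apply h]
    exact h1

theorem isBowtie_bowtieLieAlgebroid (h : IsMatchedPair LA.toStr LB.toStr DA DB) :
    IsBowtie LA LB DA DB (bowtieLieAlgebroid h) where
  anchor_eq _ _ _ := LinearMap.coprod_apply _ _ _
  bracket_eq _ _ _ _ := rfl

/-- The defining formulas of `A ⋈ B` are taken on sections with one component zero, so the
cohomology statement covers every structure satisfying them and not only the one constructed. -/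
theorem IsBowtie.isBowtieEmbedding {C : LieAlgebroid 𝕂 E (F₁ × F₂) (A ×ᵇ B)}
    (hC : IsBowtie LA LB DA DB C) :
    IsBowtieEmbedding LA.toStr LB.toStr DA.toConnection DB.toConnection C.toStr
      (sectionInl 𝕂 E F₁ A F₂ B) (sectionInr 𝕂 E F₁ A F₂ B) where
  bracket_inl X X' := (hC.bracket_eq X X' 0 0).trans (by simp; rfl)
  bracket_inr Y Y' := (hC.bracket_eq 0 0 Y Y').trans (by simp; rfl)
  bracket_inl_inr X Y := by
    refine (hC.bracket_eq X 0 0 Y).trans ((sectionSumEquiv 𝕂 E F₁ A F₂ B).injective ?_)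
    rw [map_sub]
    refine (Prod.ext ?_ ?_ : _ = ((0 : Cₛ^∞⟮𝓘(ℝ, E); F₁, A⟯), DA.nabla X Y) - (DB.nabla Y X, 0))
    all_goals simp [sectionSumEquiv_sectionSum]
  anchor_inl X := by
    ext f x
    refine (congrArg (tangentDeriv f x) (hC.anchor_eq x (X x) 0)).trans ?_
    rw [map_zero, add_zero]
    rfl
  anchor_inr Y := by
    ext f x
    refine (congrArg (tangentDeriv f x) (hC.anchor_eq x 0 (Y x))).trans ?_
    rw [map_zero, zero_add]
    rfl

variable (𝕂 E F₁ A F₂ B) in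
theorem restrictTotal_section_bijective (n : ℕ) :
    Function.Bijective (restrictTotal (𝕂 := 𝕂) (sectionInl 𝕂 E F₁ A F₂ B (M := M))
      (sectionInr 𝕂 E F₁ A F₂ B) n) := by
  refine ⟨restrictTotal_injective (fun q => ?_) n, restrictTotal_surjective
    (p := LinearMap.fst _ _ _ ∘ₗ (sectionSumEquiv 𝕂 E F₁ A F₂ B).toLinearMap)
    (r := LinearMap.snd _ _ _ ∘ₗ (sectionSumEquiv 𝕂 E F₁ A F₂ B).toLinearMap)
    (fun _ => rfl) (fun _ => rfl) (fun _ => rfl) (fun _ => rfl) n⟩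
  refine ⟨(sectionSumEquiv 𝕂 E F₁ A F₂ B q).1, (sectionSumEquiv 𝕂 E F₁ A F₂ B q).2, ?_⟩
  ext x : 1
  exact Prod.ext (add_zero _).symm (zero_add _).symm

end SectionSum

theorem mainTheorem11
    {𝕂 : Type*} [RCLike 𝕂]
    {E : Type*} [NormedAddCommGroup E] [NormedSpace ℝ E] [FiniteDimensional ℝ E]
    {M : Type*} [TopologicalSpace M] [ChartedSpace E M] [IsManifold 𝓘(ℝ, E) ∞ M] [T2Space M]
    {F₁ : Type*} [NormedAddCommGroup F₁] [NormedSpace ℝ F₁] [NormedSpace 𝕂 F₁]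
    [IsScalarTower ℝ 𝕂 F₁] [FiniteDimensional 𝕂 F₁]
    {A : M → Type*} [TopologicalSpace (TotalSpace F₁ A)] [∀ x, TopologicalSpace (A x)]
    [∀ x, AddCommGroup (A x)] [∀ x, Module ℝ (A x)] [∀ x, Module 𝕂 (A x)]
    [FiberBundle F₁ A] [VectorBundle ℝ F₁ A] [VectorBundle 𝕂 F₁ A]
    [ContMDiffVectorBundle ∞ F₁ A 𝓘(ℝ, E)]
    {F₂ : Type*} [NormedAddCommGroup F₂] [NormedSpace ℝ F₂] [NormedSpace 𝕂 F₂]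
    [IsScalarTower ℝ 𝕂 F₂] [FiniteDimensional 𝕂 F₂]
    {B : M → Type*} [TopologicalSpace (TotalSpace F₂ B)] [∀ x, TopologicalSpace (B x)]
    [∀ x, AddCommGroup (B x)] [∀ x, Module ℝ (B x)] [∀ x, Module 𝕂 (B x)]
    [FiberBundle F₂ B] [VectorBundle ℝ F₂ B] [VectorBundle 𝕂 F₂ B]
    [ContMDiffVectorBundle ∞ F₂ B 𝓘(ℝ, E)]
    (LA : LieAlgebroid 𝕂 E F₁ A) (LB : LieAlgebroid 𝕂 E F₂ B)
    (DA : LA.toStr.Representation Cₛ^∞⟮𝓘(ℝ, E); F₂, B⟯)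
    (DB : LB.toStr.Representation Cₛ^∞⟮𝓘(ℝ, E); F₁, A⟯) :
    (∀ k l, partialA DA.toConnection (k + 1) l ∘ₗ partialA DA.toConnection k l = 0) ∧
    (∀ k l, partialB DB.toConnection k (l + 1) ∘ₗ partialB DB.toConnection k l = 0) ∧
    (IsMatchedPair LA.toStr LB.toStr DA DB ↔
      ∀ k l, partialB DB.toConnection (k + 1) l ∘ₗ partialA DA.toConnection k l =
        partialA DA.toConnection k (l + 1) ∘ₗ partialB DB.toConnection k l) ∧
    (IsMatchedPair LA.toStr LB.toStr DA DB →
      (∃ C, IsBowtie LA LB DA DB C) ∧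
      (∀ n, totalDifferential DA.toConnection DB.toConnection (n + 1) ∘ₗ
        totalDifferential DA.toConnection DB.toConnection n = 0) ∧
      ∀ C : LieAlgebroid 𝕂 E (F₁ × F₂) (A ×ᵇ B), IsBowtie LA LB DA DB C →
        (∀ n, C.differential (n + 1) ∘ₗ C.differential n = 0) ∧
        InducesCohomologyIso C.differential
          (C' := TotalForm (SmoothFn 𝕂 E M) Cₛ^∞⟮𝓘(ℝ, E); F₁, A⟯ Cₛ^∞⟮𝓘(ℝ, E); F₂, B⟯)
          (totalDifferential DA.toConnection DB.toConnection)
          (restrictTotal (sectionInl 𝕂 E F₁ A F₂ B) (sectionInr 𝕂 E F₁ A F₂ B))) := by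
  -- Used twice: for the forward half of the equivalence and for the total complex.
  have hcomm : IsMatchedPair LA.toStr LB.toStr DA DB →
      ∀ n, totalDifferential DA.toConnection DB.toConnection (n + 1) ∘ₗ
        totalDifferential DA.toConnection DB.toConnection n = 0 := fun h =>
    totalDifferential_totalDifferential (isBowtie_bowtieLieAlgebroid h).isBowtieEmbedding
      fun n => (restrictTotal_section_bijective 𝕂 E F₁ A F₂ B n).2
  refine ⟨fun k l => LinearMap.ext (differential_differential (DA.exteriorDual l)),
    fun k l => LinearMap.ext fun α => ?_,
    ⟨fun h => partialB_partialA_of_totalDifferential (hcomm h), fun h =>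
      isMatchedPair_of_commute h exists_dual_ne_zero exists_dual_ne_zero⟩,
    fun h => ⟨⟨_, isBowtie_bowtieLieAlgebroid h⟩, hcomm h, fun C hC =>
      ⟨fun n => LinearMap.ext (differential_differential C.toStr.trivialRep),
        inducesCohomologyIso_of_bijective _ _ _
          (restrictTotal_differential hC.isBowtieEmbedding)
          (restrictTotal_section_bijective 𝕂 E F₁ A F₂ B)⟩⟩⟩
  -- `∂_B` is the differential conjugated by the exchange of arguments; the two inner exchanges in
  -- `∂_B²` cancel definitionally.
  exact congrArg (flipForm (𝕂 := 𝕂))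
    (differential_differential (DB.exteriorDual k) (flipForm (𝕂 := 𝕂) α))
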